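/- Let $a\in\mathbb{R}$, $x_a<x_b$, $T>0$, $k\in\mathbb{N}=\{0,1,2,\dots\}$, and let $u_0:\mathbb{R}\to\mathbb{R}$ be $(x_b-x_a)$-periodic and of class $C^{k+1}$ (for instance smooth). Let $u(t,x)$ be the classical ($C^1$) solution on $[0,T]$ of $u_t+a\,u_x=0$, $u(0,\cdot)=u_0$, periodic in $x$ with period $x_b-x_a$. For $N\ge 1$ put $\Delta x=(x_b-x_a)/N$ and divide $[x_a,x_b]$ into the cells $I_j=[x_{j-1/2},x_{j+1/2}]$, $j=1,\dots,N$, of length $\Delta x$ and midpoints $x_j$; cell indices are taken modulo $N$ (periodicity). Let $V_h^k$ be the space of functions whose restriction to each $I_j$ is a polynomial of degree at most $k$, and $P_k u_0\in V_h^k$ the $L^2$-projection of $u_0$. With the basis $\xi_j^m(x)=((x-x_j)/\Delta x)^m$, $0\le m\le k$, a function $v\in V_h^k$ has a vector of degrees of freedom $\mathbf v=(v_j^m)\in\mathbb{R}^{(k+1)N}$, $v|_{I_j}=\sum_m v_j^m\xi_j^m$. At an interface, $v^\pm$ are the right and left limits and $\{v\}=(v^++v^-)/2$. *Semi-discrete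 DG scheme with central flux:* $u_h:[0,T]\to V_h^k$ has degrees of freedom that are differentiable in $t$, $u_h(0)=P_ku_0$, and for all $t\in[0,T]$, all $j$ and all polynomials $\psi$ of degree at most $k$ $$\int_{I_j}\partial_t u_h\,\psi\,dx=-a\{u_h\}_{j+\frac12}\,\psi(x_{j+\frac12})+a\{u_h\}_{j-\frac12}\,\psi(x_{j-\frac12})+\int_{I_j}a\,u_h\,\psi_x\,dx .$$ *Exponential DG scheme with time step $\Delta t>0$:* $\mathbf u^0$ is the vector of degrees of freedom of $P_ku_0$, $\mathbf u^{n+1}=\exp(a\,\Delta t\,A)\,\mathbf u^n$, and $u_h^n\in V_h^k$ is the function with degrees of freedom $\mathbf u^n$. Here $A$ is $\frac1{\Delta x}$ times the block circulant matrix with blocks $M^{-1}D_1$ on the diagonal, $M^{-1}D_2$ coupling a cell to the next one and $M^{-1}D_3$ coupling it to the previous one (blocks that fall on the same place when $N\le 2$ are added), where for $\ell,m=1,\dots,k+1$ $$M_{\ell,m}=\tfrac{(1/2)^{m+\ell-1}}{m+\ell-1}\bigl[1-(-1)^{m+\ell-1}\bigr],\qquad (D_2)_{\ell,m}=(-1)^m(1/2)^{m+\ell-1},\qquad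 (D_3)_{\ell,m}=(-1)^{\ell-1}(1/2)^{m+\ell-1},$$ $$(D_1)_{\ell,m}=(1/2)^{m+\ell-2}\Bigl(\tfrac{\ell-1}{m+\ell-2}-\tfrac12\Bigr)\bigl[1-(-1)^{m+\ell-2}\bigr],\qquad (D_1)_{1,1}=0 .$$ Then there is a constant $C>0$, which may depend on $a,x_a,x_b,T,k,u$ but not on $N$ (that is, not on $\Delta x$), nor on $\Delta t$, $n$, $t$ or the numerical solutions, such that for every $N\ge1$: 1. every solution $u_h$ of the semi-discrete scheme satisfies $\|u(t,\cdot)-u_h(t,\cdot)\|_{L^2(x_a,x_b)}\le C\,\Delta x^k$ for all $t\in[0,T]$, in particular at $t=T$; 2. for every $\Delta t>0$ and every $n\in\mathbb{N}$ with $t^n=n\Delta t\le T$, the exponential scheme satisfies $\|u(t^n,\cdot)-u_h^n\|_{L^2(x_a,x_b)}\le C\,\Delta x^k$; 3. the exponential step adds no time error: in the situation of 2, $u_h(t^n,\cdot)=u_h^n$ for every solution $u_h$ of the semi-discrete scheme. -/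

import Mathlib

open MeasureTheory Polynomial

noncomputable section

namespace ExpDG

/-- Cell size of the uniform mesh of `[xa, xb]` with `N` cells. -/
def meshSize (xa xb : ℝ) (N : ℕ) : ℝ := (xb - xa) / N

/-- Left end point of the cell `j`; cells are numbered `0, …, N - 1`. -/
def leftEnd (xa xb : ℝ) (N : ℕ) (j : Fin N) : ℝ := xa + (j : ℝ) * meshSize xa xb N

/-- Right end point of the cell `j`. -/
def rightEnd (xa xb : ℝ) (N : ℕ) (j : Fin N) : ℝ := xa + ((j : ℝ) + 1) * meshSize xa xb N

/-- Centre of the cell `j`. -/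
def center (xa xb : ℝ) (N : ℕ) (j : Fin N) : ℝ := xa + ((j : ℝ) + 1 / 2) * meshSize xa xb N

/-- Vectors of degrees of freedom: the entry `(j, m)` is the coefficient of the `m`-th modal basis
function on the cell `j`. -/
abbrev DOF (N k : ℕ) : Type := Fin N × Fin (k + 1) → ℝ

/-- The modal basis function `((x - x_j) / Δx) ^ m` of the cell `j`. -/
def modal (xa xb : ℝ) (N : ℕ) (j : Fin N) (m : ℕ) (x : ℝ) : ℝ :=
  ((x - center xa xb N j) / meshSize xa xb N) ^ m

/-- The restriction to the (closed) cell `j` of the piecewise polynomial function with degrees of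
freedom `c`. At an interface the two adjacent cells give the two one-sided limits. -/
def recon (xa xb : ℝ) {N k : ℕ} (c : DOF N k) (j : Fin N) (x : ℝ) : ℝ :=
  ∑ m : Fin (k + 1), c (j, m) * modal xa xb N j m x

/-- The average of the left and right limits at the interface between the cell `j` and the
next one (cyclically: the addition in `Fin N` is modulo `N`, so that the cell after the last one
is the first one). -/
def centralAvg (xa xb : ℝ) {N k : ℕ} [NeZero N] (c : DOF N k) (j : Fin N) : ℝ :=
  (recon xa xb c j (rightEnd xa xb N j) + recon xa xb c (j + 1) (leftEnd xa xb N (j + 1))) / 2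

/-- The `L²(xa, xb)` distance of `v` to the piecewise polynomial function with degrees of
freedom `c`. -/
def errL2 (xa xb : ℝ) {N k : ℕ} (v : ℝ → ℝ) (c : DOF N k) : ℝ :=
  Real.sqrt (∑ j : Fin N,
    ∫ x in (leftEnd xa xb N j)..(rightEnd xa xb N j), (v x - recon xa xb c j x) ^ 2)

/-- `c` is the vector of degrees of freedom of the `L²`-projection of `v` onto the space of
piecewise polynomials of degree at most `k`. -/
def IsL2Projection (xa xb : ℝ) {N k : ℕ} (v : ℝ → ℝ) (c : DOF N k) : Prop :=
  ∀ (j : Fin N) (ψ : ℝ[X]), ψ.natDegree ≤ k →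
    ∫ x in (leftEnd xa xb N j)..(rightEnd xa xb N j), recon xa xb c j x * ψ.eval x =
      ∫ x in (leftEnd xa xb N j)..(rightEnd xa xb N j), v x * ψ.eval x

/-- `u` is, on `[0, T]`, a classical solution of `∂ₜ u + a ∂ₓ u = 0` with initial value `u₀` and
periodic boundary conditions on `[xa, xb]`. -/
structure IsTransportSolution (a xa xb T : ℝ) (u₀ : ℝ → ℝ) (u : ℝ → ℝ → ℝ) : Prop where
  regular : ContDiffOn ℝ 1 (Function.uncurry u) (Set.Icc 0 T ×ˢ Set.univ)
  periodic : ∀ t ∈ Set.Icc 0 T, Function.Periodic (u t) (xb - xa)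
  initial : ∀ x, u 0 x = u₀ x
  equation : ∀ t ∈ Set.Icc 0 T, ∀ x,
    derivWithin (fun s => u s x) (Set.Icc 0 T) t + a * deriv (u t) x = 0

/-- `c` is, on `[0, T]`, the vector of degrees of freedom of a solution of the semi-discrete DG
scheme with central flux for `∂ₜ u + a ∂ₓ u = 0`, started at the `L²`-projection of `u₀`. As the
basis does not depend on time, `∂ₜ u_h` has the degrees of freedom `c'`. -/
structure IsSemiDiscreteDG (a xa xb T : ℝ) {N k : ℕ} [NeZero N] (u₀ : ℝ → ℝ)
    (c : ℝ → DOF N k) : Prop where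
  differentiable : DifferentiableOn ℝ c (Set.Icc 0 T)
  initial : IsL2Projection xa xb u₀ (c 0)
  scheme : ∀ t ∈ Set.Icc 0 T, ∀ (j : Fin N) (ψ : ℝ[X]), ψ.natDegree ≤ k →
    ∫ x in (leftEnd xa xb N j)..(rightEnd xa xb N j),
        recon xa xb (derivWithin c (Set.Icc 0 T) t) j x * ψ.eval x =
      -(a * centralAvg xa xb (c t) j) * ψ.eval (rightEnd xa xb N j)
        + (a * centralAvg xa xb (c t) (j - 1)) * ψ.eval (leftEnd xa xb N j)
        + ∫ x in (leftEnd xa xb N j)..(rightEnd xa xb N j),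
            (a * recon xa xb (c t) j x) * ψ.derivative.eval x

/-- The mass matrix of the reference cell. Here and below the row index `l` and the column index
`m` start at `0`. -/
def massM (k : ℕ) : Matrix (Fin (k + 1)) (Fin (k + 1)) ℝ := Matrix.of fun l m =>
  (1 / 2 : ℝ) ^ ((m : ℕ) + l + 1) / ((m : ℝ) + l + 1) * (1 - (-1 : ℝ) ^ ((m : ℕ) + l + 1))

/-- The entry `(0, 0)` is `0`, because of the last factor. -/
def matD1 (k : ℕ) : Matrix (Fin (k + 1)) (Fin (k + 1)) ℝ := Matrix.of fun l m =>
  (1 / 2 : ℝ) ^ ((m : ℕ) + l) * ((l : ℝ) / ((m : ℝ) + l) - 1 / 2)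
    * (1 - (-1 : ℝ) ^ ((m : ℕ) + l))

def matD2 (k : ℕ) : Matrix (Fin (k + 1)) (Fin (k + 1)) ℝ := Matrix.of fun l m =>
  (-1 : ℝ) ^ ((m : ℕ) + 1) * (1 / 2 : ℝ) ^ ((m : ℕ) + l + 1)

def matD3 (k : ℕ) : Matrix (Fin (k + 1)) (Fin (k + 1)) ℝ := Matrix.of fun l m =>
  (-1 : ℝ) ^ (l : ℕ) * (1 / 2 : ℝ) ^ ((m : ℕ) + l + 1)

/-- The DG-matrix: `1 / Δx` times the block circulant matrix with blocks `C₁ = M⁻¹ D₁` on the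
diagonal, `C₂ = M⁻¹ D₂` for the next cell and `C₃ = M⁻¹ D₃` for the previous cell, cyclically.
(If `N ≤ 2`, blocks that fall on the same place are added.) -/
def dgMatrix (xa xb : ℝ) (N k : ℕ) [NeZero N] :
    Matrix (Fin N × Fin (k + 1)) (Fin N × Fin (k + 1)) ℝ := Matrix.of fun p q =>
  (1 / meshSize xa xb N) *
    ((if q.1 = p.1 then ((massM k)⁻¹ * matD1 k) p.2 q.2 else 0)
      + (if q.1 = p.1 + 1 then ((massM k)⁻¹ * matD2 k) p.2 q.2 else 0)
      + (if q.1 = p.1 - 1 then ((massM k)⁻¹ * matD3 k) p.2 q.2 else 0))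

/-- `U` is the sequence of vectors produced by the exponential DG scheme with time step `Δt` for
`∂ₜ u + a ∂ₓ u = 0`, started at the `L²`-projection of `u₀`. -/
structure IsExpDG (a xa xb Δt : ℝ) {N k : ℕ} [NeZero N] (u₀ : ℝ → ℝ) (U : ℕ → DOF N k) :
    Prop where
  initial : IsL2Projection xa xb u₀ (U 0)
  step : ∀ n, U (n + 1) =
    (NormedSpace.exp ((a * Δt) • dgMatrix xa xb N k)).mulVec (U n)

end ExpDG

end

noncomputable section

namespace ExpDG

open Matrix
open scoped Nat

/-! Along characteristics the classical solution is `u₀ (x - a t)`. It is compared not with its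
projection but with `taylorDOF`, which on each cell is the degree-`k` Taylor polynomial of `u₀` at
the transported centre `x_j - a t`. Write `h` for the cell size.

Consistency (`abs_residual_le`): inserted into the scheme, the time derivative of this interpolant
cancels its space derivative except for the top-order term, and the two cells at an interface
approximate the same value of `u₀`, so the flux errors are jumps of order `h ^ (k + 1)`. The mass
matrix carries a factor `h` in the scheme; dividing by it leaves order `h ^ k`, which is the lost
power.

Stability (`energy_le_of_residual_le`): central fluxes make the spatial operator antisymmetric
(`sum_dotProduct_fluxOp`), so only the residual can feed the energy, and Gronwall bounds it on `[0,
T]`. Summing over `N` cells with weight `h` gives the fixed length `xb - xa`, so the constant does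
not depend on `N`.

Exactness in time: inverting the mass matrix turns the scheme into the linear system `c' = a A c`
(`scheme_iff`, `scheme_iff_dgMatrix`). Its only solution is the matrix exponential, and `n`
exponential steps compose to the flow at time `n Δt`. The estimate for the exponential scheme is
therefore the semi-discrete one applied to this flow. -/

lemma meshSize_pos {xa xb : ℝ} (hx : xa < xb) (N : ℕ) [NeZero N] : 0 < meshSize xa xb N :=
  div_pos (sub_pos.2 hx) (Nat.cast_pos.2 (Nat.pos_of_ne_zero (NeZero.ne N)))

lemma meshSize_mul (xa xb : ℝ) (N : ℕ) [NeZero N] : N * meshSize xa xb N = xb - xa :=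
  mul_div_cancel₀ _ (Nat.cast_ne_zero.2 (NeZero.ne N))

lemma meshSize_le {xa xb : ℝ} (hx : xa < xb) (N : ℕ) [NeZero N] :
    meshSize xa xb N ≤ xb - xa := by
  rw [← meshSize_mul xa xb N]
  have h1 : (1 : ℝ) ≤ N := by exact_mod_cast Nat.pos_of_ne_zero (NeZero.ne N)
  nlinarith [meshSize_pos hx N]

/-! ### Reference cell, moments and mass matrix -/

/-- The local coordinate of the cell `j`, with values in `[-1/2, 1/2]`. -/
def localCoord (xa xb : ℝ) (N : ℕ) (j : Fin N) (x : ℝ) : ℝ :=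
  (x - center xa xb N j) / meshSize xa xb N

lemma localCoord_rightEnd {xa xb : ℝ} (hx : xa < xb) {N : ℕ} [NeZero N] (j : Fin N) :
    localCoord xa xb N j (rightEnd xa xb N j) = 1 / 2 := by
  have := (meshSize_pos hx N).ne'
  rw [localCoord, rightEnd, center]; field_simp; ring

lemma localCoord_leftEnd {xa xb : ℝ} (hx : xa < xb) {N : ℕ} [NeZero N] (j : Fin N) :
    localCoord xa xb N j (leftEnd xa xb N j) = -(1 / 2) := by
  have := (meshSize_pos hx N).ne'
  rw [localCoord, leftEnd, center]; field_simp; ring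

lemma continuous_localCoord (xa xb : ℝ) (N : ℕ) (j : Fin N) :
    Continuous (localCoord xa xb N j) := by
  unfold localCoord; fun_prop

lemma leftEnd_le_rightEnd {xa xb : ℝ} (hx : xa < xb) {N : ℕ} [NeZero N] (j : Fin N) :
    leftEnd xa xb N j ≤ rightEnd xa xb N j := by
  rw [leftEnd, rightEnd]; nlinarith [meshSize_pos hx N]

lemma rightEnd_sub_leftEnd (xa xb : ℝ) {N : ℕ} (j : Fin N) :
    rightEnd xa xb N j - leftEnd xa xb N j = meshSize xa xb N := by
  rw [leftEnd, rightEnd]; ring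

/-- The degrees of freedom of a cell. -/
def cellVec {N k : ℕ} (c : DOF N k) (j : Fin N) : Fin (k + 1) → ℝ := fun m => c (j, m)

/-- The polynomial with the given coefficients, as a function on the reference cell. -/
def refPoly {k : ℕ} (v : Fin (k + 1) → ℝ) (s : ℝ) : ℝ := ∑ m : Fin (k + 1), v m * s ^ (m : ℕ)

lemma continuous_refPoly {k : ℕ} (v : Fin (k + 1) → ℝ) : Continuous (refPoly v) := by
  unfold refPoly; fun_prop

lemma recon_eq (xa xb : ℝ) {N k : ℕ} (c : DOF N k) (j : Fin N) (x : ℝ) :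
    recon xa xb c j x = refPoly (cellVec c j) (localCoord xa xb N j x) := rfl

lemma continuous_recon (xa xb : ℝ) {N k : ℕ} (c : DOF N k) (j : Fin N) :
    Continuous (recon xa xb c j) :=
  (continuous_refPoly _).comp (continuous_localCoord xa xb N j)

/-- The moment `∫ s ^ n` over the reference cell `[-1/2, 1/2]`. -/
def moment (n : ℕ) : ℝ := (1 / 2 : ℝ) ^ (n + 1) / ((n : ℝ) + 1) * (1 - (-1 : ℝ) ^ (n + 1))

lemma integral_pow_refCell (n : ℕ) : ∫ s in (-(1 / 2) : ℝ)..(1 / 2), s ^ n = moment n := by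
  rw [integral_pow, moment, neg_pow (1 / 2 : ℝ)]; ring

lemma abs_moment_le (n : ℕ) : |moment n| ≤ 1 := by
  have h := intervalIntegral.norm_integral_le_of_norm_le_const
    (a := (-(1 / 2) : ℝ)) (b := 1 / 2) (f := fun s : ℝ => s ^ n) (C := 1) (fun s hs => by
      rw [Set.uIoc_of_le (by norm_num)] at hs
      rw [norm_pow]
      exact pow_le_one₀ (norm_nonneg _) (abs_le.2 ⟨by linarith [hs.1], by linarith [hs.2]⟩))
  rw [integral_pow_refCell] at h
  norm_num at h
  exact h

lemma massM_apply {k : ℕ} (l m : Fin (k + 1)) : massM k l m = moment (m + l) := by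
  simp only [massM, moment, of_apply]; push_cast; rfl

lemma massM_transpose (k : ℕ) : (massM k)ᵀ = massM k := by
  ext l m; simp only [transpose_apply, massM_apply, add_comm]

lemma integral_cell {xa xb : ℝ} (hx : xa < xb) {N : ℕ} [NeZero N] (j : Fin N) (g : ℝ → ℝ) :
    ∫ x in (leftEnd xa xb N j)..(rightEnd xa xb N j), g (localCoord xa xb N j x) =
      meshSize xa xb N * ∫ s in (-(1 / 2) : ℝ)..(1 / 2), g s := by
  have h := (meshSize_pos hx N).ne'
  have := intervalIntegral.integral_comp_div_sub g h (center xa xb N j / meshSize xa xb N)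
    (a := leftEnd xa xb N j) (b := rightEnd xa xb N j)
  rw [smul_eq_mul, ← sub_div, ← sub_div] at this
  simp only [← sub_div] at this
  change _ = _ * ∫ s in (localCoord xa xb N j (leftEnd xa xb N j))..(localCoord xa xb N j
    (rightEnd xa xb N j)), g s at this
  rwa [localCoord_leftEnd hx, localCoord_rightEnd hx] at this

lemma integral_refPoly_mul {k : ℕ} (v q : Fin (k + 1) → ℝ) :
    ∫ s in (-(1 / 2) : ℝ)..(1 / 2), refPoly v s * refPoly q s = q ⬝ᵥ massM k *ᵥ v := by
  have : ∀ s : ℝ, refPoly v s * refPoly q s =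
      ∑ l : Fin (k + 1), ∑ m : Fin (k + 1), (q l * v m) * s ^ ((m : ℕ) + l) := by
    intro s
    rw [refPoly, refPoly, Finset.sum_mul_sum, Finset.sum_comm]
    refine Finset.sum_congr rfl fun l _ => Finset.sum_congr rfl fun m _ => by rw [pow_add]; ring
  simp_rw [this]
  rw [intervalIntegral.integral_finsetSum
    (fun l _ => Continuous.intervalIntegrable (by fun_prop) _ _)]
  simp only [dotProduct, mulVec, Finset.mul_sum]
  refine Finset.sum_congr rfl fun l _ => ?_
  rw [intervalIntegral.integral_finsetSum
    (fun l _ => Continuous.intervalIntegrable (by fun_prop) _ _)]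
  refine Finset.sum_congr rfl fun m _ => ?_
  rw [intervalIntegral.integral_const_mul, integral_pow_refCell, massM_apply]; ring

/-- The derivative of `refPoly v`. -/
def refPolyDeriv {k : ℕ} (v : Fin (k + 1) → ℝ) (s : ℝ) : ℝ :=
  ∑ m : Fin (k + 1), v m * ((m : ℕ) * s ^ ((m : ℕ) - 1))

lemma hasDerivAt_refPoly {k : ℕ} (v : Fin (k + 1) → ℝ) (s : ℝ) :
    HasDerivAt (refPoly v) (refPolyDeriv v s) s := by
  unfold refPoly refPolyDeriv
  exact HasDerivAt.fun_sum fun m _ => (hasDerivAt_pow _ s).const_mul _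

lemma integral_refPoly_mul_deriv {k : ℕ} (v q : Fin (k + 1) → ℝ) :
    ∫ s in (-(1 / 2) : ℝ)..(1 / 2), refPoly v s * refPolyDeriv q s =
      ∑ l : Fin (k + 1), ∑ m : Fin (k + 1), q l * v m * (l * moment (m + l - 1)) := by
  have : ∀ s : ℝ, refPoly v s * refPolyDeriv q s =
      ∑ l : Fin (k + 1), ∑ m : Fin (k + 1), (q l * v m * l) * s ^ ((m : ℕ) + l - 1) := by
    intro s
    rw [refPoly, refPolyDeriv, Finset.sum_mul_sum, Finset.sum_comm]
    refine Finset.sum_congr rfl fun l _ => Finset.sum_congr rfl fun m _ => ?_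
    rcases Nat.eq_zero_or_pos (l : ℕ) with h | h
    · simp [h]
    · rw [Nat.add_sub_assoc h, pow_add]; ring
  simp_rw [this]
  rw [intervalIntegral.integral_finsetSum
    (fun l _ => Continuous.intervalIntegrable (by fun_prop) _ _)]
  refine Finset.sum_congr rfl fun l _ => ?_
  rw [intervalIntegral.integral_finsetSum
    (fun l _ => Continuous.intervalIntegrable (by fun_prop) _ _)]
  refine Finset.sum_congr rfl fun m _ => ?_
  rw [intervalIntegral.integral_const_mul, integral_pow_refCell]; ring

/-! ### Flux matrices and antisymmetry -/

/-- `matD1` collects the volume term and the interior traces of the central fluxes. -/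
lemma matD1_apply {k : ℕ} (l m : Fin (k + 1)) :
    matD1 k l m = l * moment (m + l - 1) - 1 / 2 * (1 / 2) ^ ((m : ℕ) + l)
      + 1 / 2 * (-(1 / 2)) ^ ((m : ℕ) + l) := by
  simp only [matD1, of_apply]
  rw [neg_pow (1 / 2 : ℝ)]
  rcases Nat.eq_zero_or_pos ((m : ℕ) + l) with h | h
  · have h1 : (m : ℕ) = 0 := by omega
    have h2 : (l : ℕ) = 0 := by omega
    simp [h1, h2]
  · obtain ⟨n, hn⟩ : ∃ n, (m : ℕ) + l = n + 1 := ⟨(m : ℕ) + l - 1, by omega⟩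
    have hc : ((m : ℕ) : ℝ) + (l : ℕ) = n + 1 := by exact_mod_cast hn
    rw [moment, hn, hc, Nat.add_sub_cancel]
    ring

/-- The fractions `l / (m + l)` and `m / (m + l)` add up to `1`, so subtracting `1 / 2` makes the
factor odd under the swap. This is integration by parts: central averaging keeps exactly half of
each boundary term. -/
lemma matD1_antisymm (k : ℕ) : (matD1 k)ᵀ = -matD1 k := by
  ext l m
  simp only [transpose_apply, Matrix.neg_apply, matD1, of_apply]
  rw [add_comm (l : ℕ)]
  rcases Nat.eq_zero_or_pos ((m : ℕ) + l) with h | h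
  · simp [h]
  · have hc : ((m : ℕ) : ℝ) + (l : ℕ) ≠ 0 := by exact_mod_cast h.ne'
    have : ((m : ℕ) : ℝ) / ((l : ℕ) + (m : ℕ)) = 1 - (l : ℕ) / ((m : ℕ) + (l : ℕ)) := by
      rw [add_comm ((l : ℕ) : ℝ)]; field_simp; ring
    rw [this]; ring

/-- The two couplings are the two sides of one interface, seen with opposite normals. -/
lemma matD3_transpose (k : ℕ) : (matD3 k)ᵀ = -matD2 k := by
  ext l m
  simp only [transpose_apply, Matrix.neg_apply, matD3, matD2, of_apply]
  rw [add_comm (l : ℕ)]; ring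

/-- `meshSize` times the mass matrix times the DG matrix, applied to a vector. -/
def fluxOp {N k : ℕ} [NeZero N] (c : DOF N k) (j : Fin N) : Fin (k + 1) → ℝ :=
  matD1 k *ᵥ cellVec c j + matD2 k *ᵥ cellVec c (j + 1) + matD3 k *ᵥ cellVec c (j - 1)

lemma dotProduct_matD2 {k : ℕ} (q v : Fin (k + 1) → ℝ) :
    q ⬝ᵥ matD2 k *ᵥ v = -(1 / 2) * refPoly v (-(1 / 2)) * refPoly q (1 / 2) := by
  simp only [dotProduct, mulVec, refPoly, matD2, of_apply, Finset.mul_sum, Finset.sum_mul]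
  refine Finset.sum_congr rfl fun l _ => Finset.sum_congr rfl fun m _ => ?_
  rw [neg_pow (1 / 2 : ℝ)]; ring

lemma dotProduct_matD3 {k : ℕ} (q v : Fin (k + 1) → ℝ) :
    q ⬝ᵥ matD3 k *ᵥ v = 1 / 2 * refPoly v (1 / 2) * refPoly q (-(1 / 2)) := by
  simp only [dotProduct, mulVec, refPoly, matD3, of_apply, Finset.mul_sum, Finset.sum_mul]
  refine Finset.sum_congr rfl fun l _ => Finset.sum_congr rfl fun m _ => ?_
  rw [neg_pow (1 / 2 : ℝ)]; ring

lemma dotProduct_matD1 {k : ℕ} (q v : Fin (k + 1) → ℝ) :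
    q ⬝ᵥ matD1 k *ᵥ v =
      (∫ s in (-(1 / 2) : ℝ)..(1 / 2), refPoly v s * refPolyDeriv q s)
        - 1 / 2 * refPoly v (1 / 2) * refPoly q (1 / 2)
        + 1 / 2 * refPoly v (-(1 / 2)) * refPoly q (-(1 / 2)) := by
  rw [integral_refPoly_mul_deriv]
  simp only [dotProduct, mulVec, refPoly, matD1_apply, Finset.mul_sum, Finset.sum_mul]
  rw [← Finset.sum_sub_distrib, ← Finset.sum_add_distrib]
  refine Finset.sum_congr rfl fun l _ => ?_
  rw [← Finset.sum_sub_distrib, ← Finset.sum_add_distrib]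
  refine Finset.sum_congr rfl fun m _ => ?_
  rw [pow_add, pow_add]; ring

/-- The discrete spatial operator with central fluxes is antisymmetric. -/
lemma sum_dotProduct_fluxOp {N k : ℕ} [NeZero N] (c : DOF N k) :
    ∑ j, cellVec c j ⬝ᵥ fluxOp c j = 0 := by
  have h1 : ∀ v : Fin (k + 1) → ℝ, v ⬝ᵥ matD1 k *ᵥ v = 0 := by
    intro v
    have : v ⬝ᵥ matD1 k *ᵥ v = -(v ⬝ᵥ matD1 k *ᵥ v) := by
      conv_lhs => rw [dotProduct_mulVec, ← mulVec_transpose, matD1_antisymm, neg_mulVec,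
        neg_dotProduct, dotProduct_comm]
    linarith
  have h3 : ∀ v w : Fin (k + 1) → ℝ, v ⬝ᵥ matD3 k *ᵥ w = -(w ⬝ᵥ matD2 k *ᵥ v) := by
    intro v w
    rw [dotProduct_mulVec, ← mulVec_transpose, matD3_transpose, neg_mulVec, neg_dotProduct,
      dotProduct_comm]
  simp only [fluxOp, dotProduct_add, h1, h3, zero_add, Finset.sum_add_distrib,
    Finset.sum_neg_distrib]
  -- A cyclic shift of the cells turns the previous-cell couplings into the next-cell ones, with
  -- opposite sign.
  rw [← Equiv.sum_comp (Equiv.addRight (1 : Fin N)) fun j =>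
    cellVec c (j - 1) ⬝ᵥ matD2 k *ᵥ cellVec c j]
  simp

/-! ### Definiteness of the mass matrix and the global DG matrix -/

/-- The form is the integral of a continuous square, so the polynomial vanishes on the whole
reference cell and has infinitely many roots. -/
lemma eq_zero_of_dotProduct_massM_eq_zero {k : ℕ} {v : Fin (k + 1) → ℝ}
    (h : v ⬝ᵥ massM k *ᵥ v = 0) : v = 0 := by
  rw [← integral_refPoly_mul] at h
  have hc : Continuous fun s => refPoly v s * refPoly v s :=
    (continuous_refPoly v).mul (continuous_refPoly v)
  have hz : ∀ s ∈ Set.Icc (-(1 / 2) : ℝ) (1 / 2), refPoly v s = 0 := by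
    intro s hs
    by_contra hne
    have := intervalIntegral.integral_pos (a := (-(1 / 2) : ℝ)) (b := 1 / 2) (by norm_num)
      hc.continuousOn (fun x _ => mul_self_nonneg _)
      ⟨s, hs, mul_self_pos.2 hne⟩
    linarith
  set p : ℝ[X] := ∑ m : Fin (k + 1), C (v m) * X ^ (m : ℕ) with hp
  have hpe : ∀ s, p.eval s = refPoly v s := by
    intro s; simp [hp, eval_finsetSum, refPoly]
  have hp0 : p = 0 := by
    refine Polynomial.eq_zero_of_infinite_isRoot p
      (Set.Infinite.mono (fun s hs => ?_)
        (Set.Icc_infinite (show (-(1 / 2) : ℝ) < 1 / 2 by norm_num)))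
    exact (hpe s).trans (hz s hs)
  ext m
  have := congrArg (fun q => q.coeff m) hp0
  simpa [hp, finsetSum_coeff, coeff_C_mul, coeff_X_pow, Fin.val_inj] using this

lemma dotProduct_massM_nonneg {k : ℕ} (v : Fin (k + 1) → ℝ) : 0 ≤ v ⬝ᵥ massM k *ᵥ v := by
  rw [← integral_refPoly_mul]
  exact intervalIntegral.integral_nonneg (by norm_num) fun s _ => mul_self_nonneg _

lemma isUnit_det_massM (k : ℕ) : IsUnit (massM k).det := by
  rw [← isUnit_iff_isUnit_det, ← mulVec_injective_iff_isUnit]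
  intro v w hvw
  have : massM k *ᵥ (v - w) = 0 := by rw [mulVec_sub]; exact sub_eq_zero.2 hvw
  exact sub_eq_zero.1 (eq_zero_of_dotProduct_massM_eq_zero (by rw [this, dotProduct_zero]))

lemma meshSize_smul_dgMatrix_mulVec {xa xb : ℝ} {N k : ℕ} [NeZero N] (c : DOF N k) (j : Fin N) :
    cellVec (dgMatrix xa xb N k *ᵥ c) j =
      (1 / meshSize xa xb N) • ((massM k)⁻¹ *ᵥ fluxOp c j) := by
  ext l
  -- The three block terms are summed separately, so coinciding neighbours (`N ≤ 2`) need no special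
  -- case.
  have key : ∀ (i : Fin N) (B : Matrix (Fin (k + 1)) (Fin (k + 1)) ℝ),
      ∑ q : Fin N × Fin (k + 1), (if q.1 = i then B l q.2 else 0) * c q
        = (B *ᵥ cellVec c i) l := by
    intro i B
    rw [Fintype.sum_prod_type, Finset.sum_eq_single i]
    · simp [mulVec, dotProduct, cellVec]
    · intro b _ hb; simp [hb]
    · simp
  simp only [fluxOp, mulVec_add, mulVec_mulVec, Pi.smul_apply, Pi.add_apply, smul_eq_mul, ← key]
  simp only [cellVec, mulVec, dotProduct, dgMatrix, of_apply]
  simp only [← Finset.sum_add_distrib, Finset.mul_sum]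
  refine Finset.sum_congr rfl fun q _ => by ring

/-! ### The weak form as a linear system -/

/-- Polynomials of degree at most `k` in the local coordinate. -/
lemma exists_refPoly_of_polynomial {xa xb : ℝ} (hx : xa < xb) {N k : ℕ} [NeZero N] (j : Fin N)
    (ψ : ℝ[X]) (hψ : ψ.natDegree ≤ k) :
    ∃ q : Fin (k + 1) → ℝ, ∀ x, ψ.eval x = refPoly q (localCoord xa xb N j x) := by
  have h := (meshSize_pos hx N).ne'
  set p := ψ.comp (C (meshSize xa xb N) * X + C (center xa xb N j)) with hp
  have hdeg : p.natDegree < k + 1 := by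
    refine Nat.lt_succ_of_le (natDegree_comp_le.trans ?_)
    have : (C (meshSize xa xb N) * X + C (center xa xb N j)).natDegree ≤ 1 :=
      natDegree_linear_le
    nlinarith
  refine ⟨fun m => p.coeff m, fun x => ?_⟩
  have : ψ.eval x = p.eval (localCoord xa xb N j x) := by
    rw [hp, eval_comp]
    congr 1
    simp only [eval_add, eval_mul, eval_C, eval_X, localCoord]
    field_simp; ring
  rw [this, eval_eq_sum_range' hdeg, refPoly, Finset.sum_range]

lemma exists_polynomial_of_refPoly (xa xb : ℝ) {N k : ℕ} (j : Fin N) (q : Fin (k + 1) → ℝ) :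
    ∃ ψ : ℝ[X], ψ.natDegree ≤ k ∧ ∀ x, ψ.eval x = refPoly q (localCoord xa xb N j x) := by
  refine ⟨∑ m : Fin (k + 1), C (q m) *
    (C (meshSize xa xb N)⁻¹ * X + C (-center xa xb N j * (meshSize xa xb N)⁻¹)) ^ (m : ℕ), ?_, ?_⟩
  · refine natDegree_sum_le_of_forall_le _ _ fun m _ => (natDegree_C_mul_le _ _).trans ?_
    refine (natDegree_pow_le_of_le (m : ℕ) natDegree_linear_le).trans ?_
    have := m.2; omega
  · intro x
    simp only [eval_finsetSum, eval_mul, eval_C, eval_pow, eval_add, eval_X, refPoly, localCoord]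
    refine Finset.sum_congr rfl fun m _ => ?_
    congr 2; rw [div_eq_mul_inv]; ring

lemma eval_derivative_of_refPoly {xa xb : ℝ} {N k : ℕ} {j : Fin N} {q : Fin (k + 1) → ℝ}
    {ψ : ℝ[X]} (h : ∀ x, ψ.eval x = refPoly q (localCoord xa xb N j x)) (x : ℝ) :
    ψ.derivative.eval x = refPolyDeriv q (localCoord xa xb N j x) / meshSize xa xb N := by
  have h1 : HasDerivAt (localCoord xa xb N j) (1 / meshSize xa xb N) x := by
    unfold localCoord
    exact ((hasDerivAt_id x).sub_const _).div_const _
  have h2 := (hasDerivAt_refPoly q _).comp x h1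
  have h3 : (fun x => ψ.eval x) = refPoly q ∘ localCoord xa xb N j := funext h
  rw [← h3] at h2
  rw [(ψ.hasDerivAt x).unique h2]; ring

lemma integral_recon_mul {xa xb : ℝ} (hx : xa < xb) {N k : ℕ} [NeZero N] (c : DOF N k)
    (j : Fin N) (q : Fin (k + 1) → ℝ) :
    ∫ x in (leftEnd xa xb N j)..(rightEnd xa xb N j),
        recon xa xb c j x * refPoly q (localCoord xa xb N j x) =
      meshSize xa xb N * (q ⬝ᵥ massM k *ᵥ cellVec c j) := by
  rw [← integral_refPoly_mul, ← integral_cell hx j fun s => refPoly (cellVec c j) s * refPoly q s]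
  rfl

/-- The semi-discrete scheme, in terms of the degrees of freedom of a cell. -/
lemma scheme_iff {xa xb : ℝ} (hx : xa < xb) (a : ℝ) {N k : ℕ} [NeZero N] (d c : DOF N k)
    (j : Fin N) :
    (∀ ψ : ℝ[X], ψ.natDegree ≤ k →
      ∫ x in (leftEnd xa xb N j)..(rightEnd xa xb N j), recon xa xb d j x * ψ.eval x =
        -(a * centralAvg xa xb c j) * ψ.eval (rightEnd xa xb N j)
          + (a * centralAvg xa xb c (j - 1)) * ψ.eval (leftEnd xa xb N j)
          + ∫ x in (leftEnd xa xb N j)..(rightEnd xa xb N j),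
              (a * recon xa xb c j x) * ψ.derivative.eval x) ↔
    meshSize xa xb N • (massM k *ᵥ cellVec d j) = a • fluxOp c j := by
  have hh := (meshSize_pos hx N).ne'
  have key : ∀ (ψ : ℝ[X]) (q : Fin (k + 1) → ℝ),
      (∀ x, ψ.eval x = refPoly q (localCoord xa xb N j x)) →
      ((∫ x in (leftEnd xa xb N j)..(rightEnd xa xb N j), recon xa xb d j x * ψ.eval x =
        -(a * centralAvg xa xb c j) * ψ.eval (rightEnd xa xb N j)
          + (a * centralAvg xa xb c (j - 1)) * ψ.eval (leftEnd xa xb N j)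
          + ∫ x in (leftEnd xa xb N j)..(rightEnd xa xb N j),
              (a * recon xa xb c j x) * ψ.derivative.eval x) ↔
      q ⬝ᵥ (meshSize xa xb N • (massM k *ᵥ cellVec d j)) = q ⬝ᵥ (a • fluxOp c j)) := by
    intro ψ q hq
    have e1 : ∫ x in (leftEnd xa xb N j)..(rightEnd xa xb N j), recon xa xb d j x * ψ.eval x =
        q ⬝ᵥ (meshSize xa xb N • (massM k *ᵥ cellVec d j)) := by
      simp_rw [hq]
      rw [integral_recon_mul hx, dotProduct_smul, smul_eq_mul]
    have e2 : ∫ x in (leftEnd xa xb N j)..(rightEnd xa xb N j),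
          (a * recon xa xb c j x) * ψ.derivative.eval x =
        a * ∫ s in (-(1 / 2) : ℝ)..(1 / 2), refPoly (cellVec c j) s * refPolyDeriv q s := by
      simp_rw [eval_derivative_of_refPoly hq, recon_eq]
      rw [integral_cell hx j fun s => a * refPoly (cellVec c j) s *
        (refPolyDeriv q s / meshSize xa xb N), ← intervalIntegral.integral_const_mul,
        ← intervalIntegral.integral_const_mul]
      congr 1; ext s; field_simp
    rw [e1, e2, hq, hq, localCoord_leftEnd hx, localCoord_rightEnd hx, centralAvg, centralAvg,
      sub_add_cancel, dotProduct_smul a q, smul_eq_mul, fluxOp, dotProduct_add, dotProduct_add,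
      dotProduct_matD1, dotProduct_matD2, dotProduct_matD3]
    simp only [recon_eq, localCoord_leftEnd hx, localCoord_rightEnd hx]
    constructor <;> intro h <;> rw [h] <;> ring
  constructor
  · intro h
    -- Testing with the polynomial whose coefficients are the defect itself makes the defect
    -- orthogonal to itself.
    rw [← sub_eq_zero, ← dotProduct_self_eq_zero]
    obtain ⟨ψ, hψ, hq⟩ := exists_polynomial_of_refPoly xa xb j
      (meshSize xa xb N • (massM k *ᵥ cellVec d j) - a • fluxOp c j)
    rw [dotProduct_sub, sub_eq_zero]
    exact (key ψ _ hq).1 (h ψ hψ)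
  · intro h ψ hψ
    obtain ⟨q, hq⟩ := exists_refPoly_of_polynomial hx j ψ hψ
    exact (key ψ q hq).2 (by rw [h])

lemma scheme_iff_dgMatrix {xa xb : ℝ} (hx : xa < xb) (a : ℝ) {N k : ℕ} [NeZero N]
    (d c : DOF N k) :
    (∀ j, meshSize xa xb N • (massM k *ᵥ cellVec d j) = a • fluxOp c j) ↔
      d = (a • dgMatrix xa xb N k) *ᵥ c := by
  have hh := (meshSize_pos hx N).ne'
  have hdet := isUnit_det_massM k
  have hcell : cellVec (N := N) ((a • dgMatrix xa xb N k) *ᵥ c) = fun j =>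
      a • (1 / meshSize xa xb N) • ((massM k)⁻¹ *ᵥ fluxOp c j) := by
    ext1 j
    rw [← meshSize_smul_dgMatrix_mulVec, smul_mulVec]; rfl
  constructor
  · intro h
    ext ⟨j, l⟩
    have : cellVec d j = cellVec ((a • dgMatrix xa xb N k) *ᵥ c) j := by
      rw [hcell]
      have h1 := congrArg (fun v => (massM k)⁻¹ *ᵥ v) (h j)
      simp only [mulVec_smul, mulVec_mulVec, nonsing_inv_mul _ hdet, one_mulVec] at h1
      change _ = a • (1 / meshSize xa xb N) • ((massM k)⁻¹ *ᵥ fluxOp c j)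
      rw [smul_comm, ← h1, smul_smul, one_div, inv_mul_cancel₀ hh, one_smul]
    exact congrFun this l
  · rintro h j
    rw [h, hcell]
    simp only [mulVec_smul, mulVec_mulVec, mul_nonsing_inv _ hdet, one_mulVec]
    rw [smul_comm, smul_smul (meshSize xa xb N), mul_one_div_cancel hh, one_smul]

lemma IsL2Projection.dotProduct_massM {xa xb : ℝ} (hx : xa < xb) {N k : ℕ} [NeZero N] {v : ℝ → ℝ}
    {c : DOF N k} (h : IsL2Projection xa xb v c) (j : Fin N) (q : Fin (k + 1) → ℝ) :
    meshSize xa xb N * (q ⬝ᵥ massM k *ᵥ cellVec c j) =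
      ∫ x in (leftEnd xa xb N j)..(rightEnd xa xb N j),
        v x * refPoly q (localCoord xa xb N j x) := by
  obtain ⟨ψ, hψ, hq⟩ := exists_polynomial_of_refPoly xa xb j q
  have := h j ψ hψ
  simp_rw [hq] at this
  rw [← this, integral_recon_mul hx]

/-- Both projections have the same moments; definiteness is applied to their difference. This
identifies the initial vectors of the two schemes. -/
lemma IsL2Projection.unique {xa xb : ℝ} (hx : xa < xb) {N k : ℕ} [NeZero N] {v : ℝ → ℝ}
    {c d : DOF N k} (hc : IsL2Projection xa xb v c) (hd : IsL2Projection xa xb v d) : c = d := by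
  have hh := (meshSize_pos hx N).ne'
  ext ⟨j, l⟩
  have h : ∀ q, q ⬝ᵥ massM k *ᵥ (cellVec c j - cellVec d j) = 0 := by
    intro q
    have := (IsL2Projection.dotProduct_massM hx hc j q).trans
      (IsL2Projection.dotProduct_massM hx hd j q).symm
    rw [mulVec_sub, dotProduct_sub, mul_left_cancel₀ hh this, sub_self]
  exact congrFun (sub_eq_zero.1 (eq_zero_of_dotProduct_massM_eq_zero (h _))) l

/-! ### Characteristics -/

/-- The classical solution of the transport equation is constant along characteristics. -/
lemma IsTransportSolution.eq_initial {a xa xb T : ℝ} (hT : 0 < T) {u₀ : ℝ → ℝ} {u : ℝ → ℝ → ℝ}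
    (hu : IsTransportSolution a xa xb T u₀ u) {t : ℝ} (ht : t ∈ Set.Icc 0 T) (x : ℝ) :
    u t x = u₀ (x - a * t) := by
  have hD := hu.regular.differentiableOn one_ne_zero
  have hU : UniqueDiffOn ℝ (Set.Icc 0 T) := uniqueDiffOn_Icc hT
  have hg : ∀ s ∈ Set.Icc 0 T,
      HasDerivWithinAt (fun s => u s (x - a * t + a * s)) 0 (Set.Icc 0 T) s := by
    intro s hs
    set y := x - a * t + a * s with hy
    obtain ⟨F, hF⟩ := hD (s, y) ⟨hs, Set.mem_univ _⟩
    -- Chain rule along a curve `(r, c r)` with slope `b`: `b = 0` gives the time derivative, `b =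
    -- a` the derivative along the characteristic.
    have hdir : ∀ b : ℝ, ∀ c : ℝ → ℝ, HasDerivAt c b s → c s = y →
        HasDerivWithinAt (fun r => u r (c r)) (F (1, b)) (Set.Icc 0 T) s := by
      intro b c hc hcs
      have h1 : HasDerivWithinAt (fun r : ℝ => (r, c r)) ((1 : ℝ), b) (Set.Icc 0 T) s :=
        (hasDerivAt_id s).hasDerivWithinAt.prodMk hc.hasDerivWithinAt
      rw [← hcs] at hF
      have h2 := hF.comp_hasDerivWithinAt s h1 fun r hr => Set.mk_mem_prod hr (Set.mem_univ _)
      exact h2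
    have ht' : derivWithin (fun r => u r y) (Set.Icc 0 T) s = F (1, 0) :=
      (hdir 0 (fun _ => y) (hasDerivAt_const _ _) rfl).derivWithin (hU s hs)
    have hx' : deriv (u s) y = F (0, 1) := by
      have h1 : HasDerivWithinAt (fun z : ℝ => (s, z)) ((0 : ℝ), (1 : ℝ)) Set.univ y :=
        (hasDerivWithinAt_const _ _ _).prodMk (hasDerivWithinAt_id _ _)
      have := hF.comp_hasDerivWithinAt y h1 fun z _ => ⟨hs, Set.mem_univ _⟩
      exact (hasDerivWithinAt_univ.1 this).deriv
    have heq := hu.equation s hs y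
    rw [ht', hx'] at heq
    have hsplit : F (1, a) = 0 := by
      have : ((1 : ℝ), a) = (1, 0) + a • (0, 1) := by simp
      rw [this, map_add, map_smul, smul_eq_mul, heq]
    have hchar := hdir a (fun s => x - a * t + a * s)
      (by simpa using ((hasDerivAt_id s).const_mul a).const_add (x - a * t)) rfl
    rwa [hsplit] at hchar
  have := constant_of_derivWithin_zero (fun s hs => (hg s hs).differentiableWithinAt)
    (fun s hs => (hg s (Set.Ico_subset_Icc_self hs)).derivWithin
      (hU s (Set.Ico_subset_Icc_self hs))) t ht
  simpa [hu.initial] using this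

/-! ### Taylor approximation -/

/-- Taylor's formula with a remainder bound on either side of the base point. -/
lemma abs_sub_taylor_le {K : ℝ} (n : ℕ) (f : ℝ → ℝ) (hf : ContDiff ℝ n f)
    (hK : ∀ x, |iteratedDeriv n f x| ≤ K) (x y : ℝ) :
    |f y - ∑ m ∈ Finset.range n, iteratedDeriv m f x / m ! * (y - x) ^ m| ≤ K * |y - x| ^ n := by
  induction n generalizing f y with
  | zero => simpa using hK y
  | succ n ih =>
    have hK0 : 0 ≤ K := (abs_nonneg _).trans (hK x)
    have hf' : ContDiff ℝ n (deriv f) := by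
      have : ContDiff ℝ ((n : WithTop ℕ∞) + 1) f := by exact_mod_cast hf
      exact (contDiff_succ_iff_deriv.1 this).2.2
    have hdf : Differentiable ℝ f := hf.differentiable (by simp)
    have ih' := ih (deriv f) hf' (fun z => by rw [← iteratedDeriv_succ']; exact hK z)
    -- The derivative of this remainder is the remainder of `deriv f` of one order less, to which
    -- the induction hypothesis applies.
    set R : ℝ → ℝ := fun z =>
      f z - ∑ m ∈ Finset.range (n + 1), iteratedDeriv m f x / m ! * (z - x) ^ m with hR
    have hRd : ∀ z, HasDerivAt R (deriv f z -
        ∑ m ∈ Finset.range n, iteratedDeriv m (deriv f) x / m ! * (z - x) ^ m) z := by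
      intro z
      have h1 : HasDerivAt (fun z : ℝ => ∑ m ∈ Finset.range (n + 1),
          iteratedDeriv m f x / m ! * (z - x) ^ m)
          (∑ m ∈ Finset.range (n + 1), iteratedDeriv m f x / m ! * (m * (z - x) ^ (m - 1))) z := by
        refine HasDerivAt.fun_sum fun m _ => HasDerivAt.const_mul _ ?_
        simpa using ((hasDerivAt_id z).sub_const x).fun_pow m
      refine ((hdf z).hasDerivAt.sub h1).congr_deriv ?_
      congr 1
      rw [Finset.sum_range_succ']
      simp only [Nat.cast_zero, zero_mul, mul_zero, add_zero]
      refine Finset.sum_congr rfl fun m _ => ?_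
      rw [iteratedDeriv_succ', Nat.factorial_succ, Nat.add_sub_cancel]
      have : (m ! : ℝ) ≠ 0 := by exact_mod_cast Nat.factorial_ne_zero m
      push_cast; field_simp
    have hx0 : R x = 0 := by
      simp only [hR, sub_self]
      rw [Finset.sum_range_succ']; simp
    -- The mean value inequality on `Set.uIcc` covers both sides of `x`; it gives up the factor `1 /
    -- n!`, which is not needed.
    have hmv := Convex.norm_image_sub_le_of_norm_hasDerivWithin_le (f := R) (s := Set.uIcc x y)
      (C := K * |y - x| ^ n) (fun z _ => (hRd z).hasDerivWithinAt) (fun z hz => by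
        refine (ih' z).trans (mul_le_mul_of_nonneg_left ?_ hK0)
        exact pow_le_pow_left₀ (abs_nonneg _) (Set.abs_sub_left_of_mem_uIcc hz) n)
      (convex_uIcc x y) Set.left_mem_uIcc Set.right_mem_uIcc
    rw [hx0, sub_zero] at hmv
    rw [pow_succ, ← mul_assoc]
    exact hmv

lemma iteratedDeriv_periodic {f : ℝ → ℝ} {L : ℝ} (hf : Function.Periodic f L) (n : ℕ) :
    Function.Periodic (iteratedDeriv n f) L := by
  intro x
  have h := congrFun (iteratedDeriv_comp_add_const (n := n) (f := f) (s := L)) x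
  rw [← h]
  congr 1
  exact funext hf

/-- A continuous periodic function is bounded. This provides one constant `K` for all cells, meshes
and times. -/
lemma exists_abs_iteratedDeriv_le {f : ℝ → ℝ} {L : ℝ} (hL : L ≠ 0) (hf : Function.Periodic f L)
    {n : ℕ} (hfn : ContDiff ℝ n f) : ∃ K, ∀ x, |iteratedDeriv n f x| ≤ K := by
  have hb := (iteratedDeriv_periodic hf n).isBounded_of_continuous hL
    (hfn.continuous_iteratedDeriv n le_rfl)
  obtain ⟨K, hK⟩ := hb.exists_norm_le
  exact ⟨K, fun x => hK _ ⟨x, rfl⟩⟩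

/-- The Taylor polynomial of `f` at `y` on a cell of size `h`, in the local basis. -/
def localTaylor (h : ℝ) (k : ℕ) (f : ℝ → ℝ) (y : ℝ) : Fin (k + 1) → ℝ := fun m =>
  h ^ (m : ℕ) * iteratedDeriv m f y / (m : ℕ)!

lemma abs_sub_localTaylor_le {K h : ℝ} (hh : 0 ≤ h) {k : ℕ} {f : ℝ → ℝ}
    (hf : ContDiff ℝ (k + 1 : ℕ) f) (hK : ∀ x, |iteratedDeriv (k + 1) f x| ≤ K) (y : ℝ) {s : ℝ}
    (hs : |s| ≤ 1 / 2) :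
    |f (y + h * s) - refPoly (localTaylor h k f y) s| ≤ K * h ^ (k + 1) := by
  have hK0 : 0 ≤ K := (abs_nonneg _).trans (hK y)
  have ht := abs_sub_taylor_le (k + 1) f hf hK y (y + h * s)
  have hsum : ∑ m ∈ Finset.range (k + 1), iteratedDeriv m f y / m ! * (y + h * s - y) ^ m =
      refPoly (localTaylor h k f y) s := by
    rw [Finset.sum_range, refPoly]
    refine Finset.sum_congr rfl fun m _ => ?_
    rw [localTaylor, add_sub_cancel_left, mul_pow]; ring
  rw [hsum, add_sub_cancel_left] at ht
  refine ht.trans (mul_le_mul_of_nonneg_left (pow_le_pow_left₀ (abs_nonneg _) ?_ _) hK0)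
  rw [abs_mul, abs_of_nonneg hh]
  nlinarith

/-! ### Transported Taylor interpolant and consistency -/

/-- The interpolant of `u₀ (x - a t)` by Taylor polynomials at the centres of the cells. -/
def taylorDOF (a xa xb : ℝ) (N k : ℕ) (u₀ : ℝ → ℝ) (t : ℝ) : DOF N k := fun p =>
  localTaylor (meshSize xa xb N) k u₀ (center xa xb N p.1 - a * t) p.2

/-- The time derivative of `taylorDOF`. -/
def taylorDOFDeriv (a xa xb : ℝ) (N k : ℕ) (u₀ : ℝ → ℝ) (t : ℝ) : DOF N k := fun p =>
  -a * (meshSize xa xb N ^ (p.2 : ℕ) *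
    iteratedDeriv (p.2 + 1) u₀ (center xa xb N p.1 - a * t) / (p.2 : ℕ)!)

lemma hasDerivAt_taylorDOF (a xa xb : ℝ) (N k : ℕ) {u₀ : ℝ → ℝ}
    (hu₀ : ContDiff ℝ (k + 1 : ℕ) u₀) (t : ℝ) :
    HasDerivAt (taylorDOF a xa xb N k u₀) (taylorDOFDeriv a xa xb N k u₀ t) t := by
  rw [hasDerivAt_pi]
  rintro ⟨j, m⟩
  have hd : Differentiable ℝ (iteratedDeriv m u₀) :=
    hu₀.differentiable_iteratedDeriv m (by exact_mod_cast m.2)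
  have h1 : HasDerivAt (fun t => center xa xb N j - a * t) (-a) t := by
    simpa using ((hasDerivAt_id t).const_mul a).const_sub (center xa xb N j)
  have h2 := (hd (center xa xb N j - a * t)).hasDerivAt.comp t h1
  have h3 := (h2.const_mul (meshSize xa xb N ^ (m : ℕ))).div_const ((m : ℕ)! : ℝ)
  rw [← iteratedDeriv_succ] at h3
  refine h3.congr_deriv ?_
  simp only [taylorDOFDeriv]; ring

/-- Only the last cell wraps around, which costs one period (`z = -1`); periodicity of `u₀` then
hides the wrap. -/
lemma exists_center_add_one (xa xb : ℝ) {N : ℕ} [NeZero N] (j : Fin N) :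
    ∃ z : ℤ, center xa xb N (j + 1) =
      center xa xb N j + meshSize xa xb N + z * (xb - xa) := by
  have hval : ((j + 1 : Fin N) : ℕ) = ((j : ℕ) + 1) % N := by
    rw [Fin.val_add, Fin.val_one', Nat.add_mod_mod]
  rcases Nat.lt_or_ge ((j : ℕ) + 1) N with h | h
  · refine ⟨0, ?_⟩
    rw [Nat.mod_eq_of_lt h] at hval
    simp only [center, hval]; push_cast; ring
  · refine ⟨-1, ?_⟩
    have hN : (j : ℕ) + 1 = N := le_antisymm j.2 h
    rw [hN, Nat.mod_self] at hval
    have hc : ((j : ℕ) : ℝ) = N - 1 := by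
      rw [eq_sub_iff_add_eq]; exact_mod_cast hN
    simp only [center, hval, ← meshSize_mul xa xb N, hc]; push_cast; ring

lemma localTaylor_add_period {h L : ℝ} {k : ℕ} {f : ℝ → ℝ} (hf : Function.Periodic f L) (y : ℝ)
    (z : ℤ) : localTaylor h k f (y + z * L) = localTaylor h k f y := by
  ext m
  rw [localTaylor, localTaylor, (iteratedDeriv_periodic hf m).int_mul z y]

lemma cellVec_taylorDOF_add_one {a xa xb : ℝ} {N k : ℕ} [NeZero N] {u₀ : ℝ → ℝ}
    (hper : Function.Periodic u₀ (xb - xa)) (t : ℝ) (j : Fin N) :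
    cellVec (taylorDOF a xa xb N k u₀ t) (j + 1) = localTaylor (meshSize xa xb N) k u₀
      (center xa xb N j - a * t + meshSize xa xb N) := by
  obtain ⟨z, hz⟩ := exists_center_add_one xa xb j
  rw [← localTaylor_add_period hper _ z]
  ext m
  simp only [cellVec, taylorDOF, hz]
  congr 1; ring

lemma cellVec_taylorDOF_sub_one {a xa xb : ℝ} {N k : ℕ} [NeZero N] {u₀ : ℝ → ℝ}
    (hper : Function.Periodic u₀ (xb - xa)) (t : ℝ) (j : Fin N) :
    cellVec (taylorDOF a xa xb N k u₀ t) (j - 1) = localTaylor (meshSize xa xb N) k u₀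
      (center xa xb N j - a * t - meshSize xa xb N) := by
  obtain ⟨z, hz⟩ := exists_center_add_one xa xb (j - 1)
  rw [sub_add_cancel] at hz
  rw [hz, ← localTaylor_add_period hper _ (-z)]
  ext m
  simp only [cellVec, taylorDOF]
  congr 1; push_cast; ring

/-- Antisymmetry moves the derivative from the test monomial to `v`, the form in which it can cancel
against the time derivative. -/
lemma matD1_mulVec_apply {k : ℕ} (v : Fin (k + 1) → ℝ) (l : Fin (k + 1)) :
    (matD1 k *ᵥ v) l = 1 / 2 * refPoly v (1 / 2) * (1 / 2) ^ (l : ℕ)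
      - 1 / 2 * refPoly v (-(1 / 2)) * (-(1 / 2)) ^ (l : ℕ)
      - ∑ m : Fin (k + 1), v m * (m * moment (m + l - 1)) := by
  simp only [mulVec, dotProduct, refPoly, Finset.mul_sum, Finset.sum_mul]
  rw [← Finset.sum_sub_distrib, ← Finset.sum_sub_distrib]
  refine Finset.sum_congr rfl fun m _ => ?_
  have h : matD1 k l m = -matD1 k m l := by
    have := congrFun (congrFun (matD1_antisymm k) m) l
    simpa using this
  rw [h, matD1_apply, add_comm (l : ℕ) m, pow_add, pow_add]; ring

lemma matD2_mulVec_apply {k : ℕ} (v : Fin (k + 1) → ℝ) (l : Fin (k + 1)) :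
    (matD2 k *ᵥ v) l = -(1 / 2) * refPoly v (-(1 / 2)) * (1 / 2) ^ (l : ℕ) := by
  simp only [mulVec, dotProduct, refPoly, matD2, of_apply, Finset.mul_sum, Finset.sum_mul]
  refine Finset.sum_congr rfl fun m _ => ?_
  rw [neg_pow (1 / 2 : ℝ)]; ring

lemma matD3_mulVec_apply {k : ℕ} (v : Fin (k + 1) → ℝ) (l : Fin (k + 1)) :
    (matD3 k *ᵥ v) l = 1 / 2 * refPoly v (1 / 2) * (-(1 / 2)) ^ (l : ℕ) := by
  simp only [mulVec, dotProduct, refPoly, matD3, of_apply, Finset.mul_sum, Finset.sum_mul]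
  refine Finset.sum_congr rfl fun m _ => ?_
  rw [neg_pow (1 / 2 : ℝ)]; ring

/-- The time and space derivatives of the transported Taylor polynomial cancel up to the term of
highest order. -/
lemma massM_mulVec_taylorDOFDeriv (a xa xb : ℝ) (N k : ℕ) (u₀ : ℝ → ℝ) (t : ℝ) (j : Fin N)
    (l : Fin (k + 1)) :
    meshSize xa xb N * (massM k *ᵥ cellVec (taylorDOFDeriv a xa xb N k u₀ t) j) l
      + a * ∑ m : Fin (k + 1), cellVec (taylorDOF a xa xb N k u₀ t) j m *
          (m * moment (m + l - 1)) =
      -a * (meshSize xa xb N ^ (k + 1) *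
        iteratedDeriv (k + 1) u₀ (center xa xb N j - a * t) / k ! * moment (k + l)) := by
  simp only [mulVec, dotProduct, massM_apply]
  -- The time sum loses its top term and the space sum its zeroth term, which is `0`; the rest
  -- cancels with index `m` against `m + 1`.
  rw [Fin.sum_univ_castSucc, Fin.sum_univ_succ]
  simp only [Fin.val_last, Fin.val_castSucc, Fin.val_succ, Fin.val_zero, Nat.cast_zero, zero_mul,
    mul_zero, zero_add]
  have : ∀ i : Fin k, a * (cellVec (taylorDOF a xa xb N k u₀ t) j i.succ *
      (((i : ℕ) + 1 : ℕ) * moment ((i : ℕ) + 1 + l - 1))) = -(meshSize xa xb N *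
      (moment (i + l) * cellVec (taylorDOFDeriv a xa xb N k u₀ t) j i.castSucc)) := by
    intro i
    have hi : ((i : ℕ)! : ℝ) ≠ 0 := by exact_mod_cast Nat.factorial_ne_zero _
    have e : (i : ℕ) + 1 + l - 1 = i + l := by omega
    simp only [cellVec, taylorDOF, localTaylor, taylorDOFDeriv, Fin.val_succ, Fin.val_castSucc, e,
      Nat.factorial_succ]
    push_cast
    field_simp
    ring
  rw [Finset.mul_sum, Finset.sum_congr rfl fun i _ => this i, Finset.sum_neg_distrib, mul_add,
    ← Finset.mul_sum]
  simp only [cellVec, taylorDOFDeriv, Fin.val_last]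
  ring

/-- The consistency error of the Taylor interpolant. -/
lemma abs_residual_le {a xa xb K : ℝ} (hx : xa < xb) {N k : ℕ} [NeZero N] {u₀ : ℝ → ℝ}
    (hu₀ : ContDiff ℝ (k + 1 : ℕ) u₀) (hper : Function.Periodic u₀ (xb - xa))
    (hK : ∀ x, |iteratedDeriv (k + 1) u₀ x| ≤ K) (t : ℝ) (j : Fin N) (l : Fin (k + 1)) :
    |(meshSize xa xb N • (massM k *ᵥ cellVec (taylorDOFDeriv a xa xb N k u₀ t) j)
      - a • fluxOp (taylorDOF a xa xb N k u₀ t) j) l| ≤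
      3 * |a| * K * meshSize xa xb N ^ (k + 1) := by
  have hh := (meshSize_pos hx N).le
  set h := meshSize xa xb N with hh_def
  set y := center xa xb N j - a * t with hy
  have hK0 : 0 ≤ K := (abs_nonneg _).trans (hK y)
  have hcell : cellVec (taylorDOF a xa xb N k u₀ t) j = localTaylor h k u₀ y := rfl
  have h1 := massM_mulVec_taylorDOFDeriv a xa xb N k u₀ t j l
  rw [← hh_def, ← hy] at h1
  set V := localTaylor h k u₀ y with hV
  set Vp := localTaylor h k u₀ (y + h) with hVp
  set Vm := localTaylor h k u₀ (y - h) with hVm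
  have half : |(1 / 2 : ℝ)| ≤ 1 / 2 := by norm_num
  have half' : |(-(1 / 2) : ℝ)| ≤ 1 / 2 := by rw [abs_neg]; exact half
  have b1 := abs_sub_localTaylor_le hh hu₀ hK y half
  have b2 := abs_sub_localTaylor_le hh hu₀ hK y half'
  have b3 := abs_sub_localTaylor_le hh hu₀ hK (y + h) half'
  have b4 := abs_sub_localTaylor_le hh hu₀ hK (y - h) half
  rw [show y + h + h * -(1 / 2) = y + h * (1 / 2) by ring] at b3
  rw [show y - h + h * (1 / 2) = y + h * -(1 / 2) by ring] at b4
  set B := K * h ^ (k + 1) with hB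
  have hB0 : 0 ≤ B := by positivity
  -- Both one-sided values approximate the same value of `u₀` at the interface, each within `B`.
  have j1 : |refPoly V (1 / 2) - refPoly Vp (-(1 / 2))| ≤ 2 * B := by
    rw [abs_le] at *; constructor <;> linarith [b1.1, b1.2, b3.1, b3.2]
  have j2 : |refPoly Vm (1 / 2) - refPoly V (-(1 / 2))| ≤ 2 * B := by
    rw [abs_le] at *; constructor <;> linarith [b2.1, b2.2, b4.1, b4.2]
  -- The residual is the uncancelled top-order term plus one jump per interface; each is at most
  -- `B`, hence the constant `3`.
  have expand : (h • (massM k *ᵥ cellVec (taylorDOFDeriv a xa xb N k u₀ t) j)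
      - a • fluxOp (taylorDOF a xa xb N k u₀ t) j) l =
      -a * (h ^ (k + 1) * iteratedDeriv (k + 1) u₀ y / k ! * moment (k + l)
        + 1 / 2 * (1 / 2) ^ (l : ℕ) * (refPoly V (1 / 2) - refPoly Vp (-(1 / 2)))
        + 1 / 2 * (-(1 / 2)) ^ (l : ℕ) * (refPoly Vm (1 / 2) - refPoly V (-(1 / 2)))) := by
    rw [hcell] at h1
    simp only [fluxOp, Pi.sub_apply, Pi.smul_apply, Pi.add_apply, smul_eq_mul,
      cellVec_taylorDOF_add_one hper, cellVec_taylorDOF_sub_one hper, hcell, matD1_mulVec_apply,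
      matD2_mulVec_apply, matD3_mulVec_apply]
    linear_combination h1
  have p0 : |h ^ (k + 1) * iteratedDeriv (k + 1) u₀ y / k ! * moment (k + l)| ≤ B := by
    rw [abs_mul, abs_div, abs_mul, abs_of_nonneg (pow_nonneg hh _), Nat.abs_cast]
    have hf : (1 : ℝ) ≤ k ! := by exact_mod_cast Nat.factorial_pos k
    calc _ ≤ h ^ (k + 1) * |iteratedDeriv (k + 1) u₀ y| / 1 * 1 := by
          gcongr
          exact abs_moment_le _
      _ ≤ B := by
          rw [div_one, mul_one, hB, mul_comm]
          exact mul_le_mul_of_nonneg_right (hK y) (by positivity)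
  have hpow : ∀ r : ℝ, |r| ≤ 1 / 2 → |1 / 2 * r ^ (l : ℕ)| ≤ 1 / 2 := by
    intro r hr
    rw [abs_mul, abs_pow]
    have := pow_le_one₀ (n := (l : ℕ)) (abs_nonneg r) (hr.trans (by norm_num))
    calc _ ≤ 1 / 2 * 1 := mul_le_mul half this (by positivity) (by norm_num)
      _ = _ := by norm_num
  have pp : ∀ r d : ℝ, |r| ≤ 1 / 2 → |d| ≤ 2 * B → |1 / 2 * r ^ (l : ℕ) * d| ≤ B := by
    intro r d hr hd
    rw [abs_mul]
    calc _ ≤ 1 / 2 * (2 * B) := mul_le_mul (hpow r hr) hd (abs_nonneg _) (by norm_num)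
      _ = B := by ring
  rw [expand, abs_mul, abs_neg]
  calc _ ≤ |a| * (B + B + B) := by
        refine mul_le_mul_of_nonneg_left ?_ (abs_nonneg _)
        exact (abs_add_three _ _ _).trans
          (add_le_add (add_le_add p0 (pp _ _ half j1)) (pp _ _ half' j2))
    _ = _ := by rw [hB]; ring

lemma abs_localCoord_le {xa xb : ℝ} (hx : xa < xb) {N : ℕ} [NeZero N] {j : Fin N} {x : ℝ}
    (hxj : x ∈ Set.Icc (leftEnd xa xb N j) (rightEnd xa xb N j)) :
    |localCoord xa xb N j x| ≤ 1 / 2 := by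
  have hh := meshSize_pos hx N
  have h1 : localCoord xa xb N j (leftEnd xa xb N j) ≤ localCoord xa xb N j x :=
    div_le_div_of_nonneg_right (sub_le_sub_right hxj.1 _) hh.le
  have h2 : localCoord xa xb N j x ≤ localCoord xa xb N j (rightEnd xa xb N j) :=
    div_le_div_of_nonneg_right (sub_le_sub_right hxj.2 _) hh.le
  rw [localCoord_leftEnd hx] at h1
  rw [localCoord_rightEnd hx] at h2
  exact abs_le.2 ⟨h1, h2⟩

lemma abs_sub_recon_taylorDOF_le {a xa xb K : ℝ} (hx : xa < xb) {N k : ℕ} [NeZero N]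
    {u₀ : ℝ → ℝ} (hu₀ : ContDiff ℝ (k + 1 : ℕ) u₀)
    (hK : ∀ x, |iteratedDeriv (k + 1) u₀ x| ≤ K) (t : ℝ) {j : Fin N} {x : ℝ}
    (hxj : x ∈ Set.Icc (leftEnd xa xb N j) (rightEnd xa xb N j)) :
    |u₀ (x - a * t) - recon xa xb (taylorDOF a xa xb N k u₀ t) j x| ≤
      K * meshSize xa xb N ^ (k + 1) := by
  have hh := meshSize_pos hx N
  have := abs_sub_localTaylor_le hh.le hu₀ hK (center xa xb N j - a * t) (abs_localCoord_le hx hxj)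
  have e : x - a * t =
      center xa xb N j - a * t + meshSize xa xb N * localCoord xa xb N j x := by
    rw [localCoord]; field_simp; ring
  rw [e]
  exact this

/-! ### Discrete energy and stability -/

/-- The squared `L²` norm of a piecewise polynomial function, divided by the cell size. -/
def energy {N k : ℕ} (v : DOF N k) : ℝ := ∑ j, cellVec v j ⬝ᵥ massM k *ᵥ cellVec v j

lemma energy_nonneg {N k : ℕ} (v : DOF N k) : 0 ≤ energy v :=
  Finset.sum_nonneg fun _ _ => dotProduct_massM_nonneg _

/-- The sum of the absolute values of the entries of the inverse mass matrix. -/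
def invMassBound (k : ℕ) : ℝ := ∑ l, ∑ m, |(massM k)⁻¹ l m|

lemma invMassBound_nonneg (k : ℕ) : 0 ≤ invMassBound k :=
  Finset.sum_nonneg fun _ _ => Finset.sum_nonneg fun _ _ => abs_nonneg _

/-- Residuals and projection errors are controlled through their moments; inverting the mass matrix
costs a constant depending on `k` only. -/
lemma abs_le_of_abs_massM_mulVec_le {k : ℕ} {v : Fin (k + 1) → ℝ} {β : ℝ}
    (h : ∀ l, |(massM k *ᵥ v) l| ≤ β) (l : Fin (k + 1)) : |v l| ≤ invMassBound k * β := by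
  have hβ : 0 ≤ β := (abs_nonneg _).trans (h l)
  have hv : v = (massM k)⁻¹ *ᵥ (massM k *ᵥ v) := by
    rw [mulVec_mulVec, nonsing_inv_mul _ (isUnit_det_massM k), one_mulVec]
  rw [hv]
  calc |∑ m, (massM k)⁻¹ l m * (massM k *ᵥ v) m| ≤ ∑ m, |(massM k)⁻¹ l m| * β := by
        refine (Finset.abs_sum_le_sum_abs _ _).trans (Finset.sum_le_sum fun m _ => ?_)
        rw [abs_mul]
        exact mul_le_mul_of_nonneg_left (h m) (abs_nonneg _)
    _ ≤ _ := by
        rw [← Finset.sum_mul]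
        refine mul_le_mul_of_nonneg_right ?_ hβ
        exact Finset.single_le_sum (f := fun l => ∑ m, |(massM k)⁻¹ l m|)
          (fun _ _ => Finset.sum_nonneg fun _ _ => abs_nonneg _) (Finset.mem_univ l)

lemma energy_le {N k : ℕ} {v : DOF N k} {β : ℝ}
    (h : ∀ j l, |(massM k *ᵥ cellVec v j) l| ≤ β) :
    energy v ≤ N * ((k + 1) * invMassBound k * β ^ 2) := by
  have hcell : ∀ j, cellVec v j ⬝ᵥ massM k *ᵥ cellVec v j ≤
      (k + 1) * invMassBound k * β ^ 2 := by
    intro j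
    calc _ ≤ ∑ _l : Fin (k + 1), invMassBound k * β * β := by
          refine Finset.sum_le_sum fun l _ => (le_abs_self _).trans ?_
          rw [abs_mul]
          have h1 := abs_le_of_abs_massM_mulVec_le (h j) l
          exact mul_le_mul h1 (h j l) (abs_nonneg _) ((abs_nonneg _).trans h1)
      _ = _ := by
          rw [Finset.sum_const, Finset.card_univ, Fintype.card_fin, nsmul_eq_mul]
          push_cast; ring
  calc _ ≤ ∑ _j : Fin N, ((k + 1) * invMassBound k * β ^ 2) :=
        Finset.sum_le_sum fun j _ => hcell j
    _ = _ := by rw [Finset.sum_const, Finset.card_univ, Fintype.card_fin, nsmul_eq_mul]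

lemma massM_dotProduct_comm {k : ℕ} (v w : Fin (k + 1) → ℝ) :
    v ⬝ᵥ massM k *ᵥ w = w ⬝ᵥ massM k *ᵥ v := by
  rw [dotProduct_mulVec, ← mulVec_transpose, massM_transpose, dotProduct_comm]

/-- Positivity of the mass form on `v - w`. This Young inequality lets Gronwall act on the energy
itself, without square roots. -/
lemma two_mul_sum_massM_le {N k : ℕ} (v w : DOF N k) :
    2 * ∑ j, cellVec v j ⬝ᵥ massM k *ᵥ cellVec w j ≤ energy v + energy w := by
  rw [energy, energy, ← Finset.sum_add_distrib, Finset.mul_sum]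
  refine Finset.sum_le_sum fun j _ => ?_
  have h := dotProduct_massM_nonneg (cellVec v j - cellVec w j)
  rw [mulVec_sub, dotProduct_sub, sub_dotProduct, sub_dotProduct,
    massM_dotProduct_comm (cellVec w j) (cellVec v j)] at h
  linarith

lemma hasDerivWithinAt_energy {N k : ℕ} {e : ℝ → DOF N k} {e' : DOF N k} {s : Set ℝ} {t : ℝ}
    (he : HasDerivWithinAt e e' s t) :
    HasDerivWithinAt (fun t => energy (e t))
      (2 * ∑ j, cellVec (e t) j ⬝ᵥ massM k *ᵥ cellVec e' j) s t := by
  have hc : ∀ j l, HasDerivWithinAt (fun t => cellVec (e t) j l) (cellVec e' j l) s t :=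
    fun j l => hasDerivWithinAt_pi.1 he (j, l)
  have h : HasDerivWithinAt (fun t => energy (e t))
      (∑ j, ∑ l, (cellVec e' j l * ∑ m, massM k l m * cellVec (e t) j m +
        cellVec (e t) j l * ∑ m, massM k l m * cellVec e' j m)) s t := by
    refine HasDerivWithinAt.fun_sum fun j _ => HasDerivWithinAt.fun_sum fun l _ => ?_
    have hM : HasDerivWithinAt (fun t => ∑ m, massM k l m * cellVec (e t) j m)
        (∑ m, massM k l m * cellVec e' j m) s t :=
      HasDerivWithinAt.fun_sum fun m _ => (hc j m).const_mul _
    exact (hc j l).mul hM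
  refine h.congr_deriv ?_
  rw [Finset.mul_sum]
  refine Finset.sum_congr rfl fun j _ => ?_
  rw [Finset.sum_add_distrib]
  change cellVec e' j ⬝ᵥ massM k *ᵥ cellVec (e t) j + cellVec (e t) j ⬝ᵥ massM k *ᵥ cellVec e' j = _
  rw [massM_dotProduct_comm]; ring

/-- Gronwall's inequality in the form `y' ≤ y + Q`. -/
lemma le_exp_mul_of_deriv_le {y y' : ℝ → ℝ} {T Q : ℝ}
    (hQ : 0 ≤ Q) (hy0 : 0 ≤ y 0) (hy : ∀ t ∈ Set.Icc 0 T, HasDerivWithinAt y (y' t) (Set.Icc 0 T) t)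
    (hle : ∀ t ∈ Set.Icc 0 T, y' t ≤ y t + Q) {t : ℝ} (ht : t ∈ Set.Icc 0 T) :
    y t ≤ Real.exp T * (y 0 + T * Q) := by
  -- Since `exp (-t) ≤ 1` for `t ≥ 0`, subtracting `Q * t` is enough to make this antitone.
  set g : ℝ → ℝ := fun t => Real.exp (-t) * y t - Q * t with hg
  have hgd : ∀ t ∈ Set.Icc 0 T,
      HasDerivWithinAt g (Real.exp (-t) * (y' t - y t) - Q) (Set.Icc 0 T) t := by
    intro t ht
    have h1 : HasDerivAt (fun t : ℝ => Real.exp (-t)) (-Real.exp (-t)) t := by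
      simpa using (hasDerivAt_neg t).exp
    refine ((h1.hasDerivWithinAt.mul (hy t ht)).sub
      (((hasDerivAt_id t).const_mul Q).hasDerivWithinAt)).congr_deriv ?_
    simp; ring
  have hanti : AntitoneOn g (Set.Icc 0 T) := by
    refine antitoneOn_of_hasDerivWithinAt_nonpos (convex_Icc 0 T)
      (f' := fun t => Real.exp (-t) * (y' t - y t) - Q)
      (fun t ht => (hgd t ht).continuousWithinAt)
      (fun t ht => (hgd t (interior_subset ht)).mono interior_subset) fun t ht => ?_
    have ht' := interior_subset ht
    have h1 : Real.exp (-t) ≤ 1 := Real.exp_le_one_iff.2 (by linarith [ht'.1])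
    have h2 : Real.exp (-t) * (y' t - y t) ≤ Real.exp (-t) * Q :=
      mul_le_mul_of_nonneg_left (by linarith [hle t ht']) (Real.exp_pos _).le
    nlinarith
  have h := hanti (Set.left_mem_Icc.2 (ht.1.trans ht.2)) ht ht.1
  simp only [hg, neg_zero, Real.exp_zero, one_mul, mul_zero, sub_zero] at h
  have hpos : 0 ≤ y 0 + T * Q := add_nonneg hy0 (mul_nonneg (ht.1.trans ht.2) hQ)
  have h3 : Real.exp (-t) * y t ≤ y 0 + T * Q := by nlinarith [ht.2]
  calc y t = Real.exp t * (Real.exp (-t) * y t) := by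
        rw [← mul_assoc, ← Real.exp_add, add_neg_cancel, Real.exp_zero, one_mul]
    _ ≤ Real.exp t * (y 0 + T * Q) := mul_le_mul_of_nonneg_left h3 (Real.exp_pos _).le
    _ ≤ _ := mul_le_mul_of_nonneg_right (Real.exp_le_exp.2 ht.2) hpos

/-- Stability of the semi-discrete scheme with respect to residuals. -/
lemma energy_le_of_residual_le {a xa xb T β : ℝ} (hx : xa < xb) {N k : ℕ} [NeZero N]
    {e e' : ℝ → DOF N k}
    (he : ∀ t ∈ Set.Icc 0 T, HasDerivWithinAt e (e' t) (Set.Icc 0 T) t)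
    (hres : ∀ t ∈ Set.Icc 0 T, ∀ j l, |(meshSize xa xb N • (massM k *ᵥ cellVec (e' t) j)
      - a • fluxOp (e t) j) l| ≤ meshSize xa xb N * β) {t : ℝ} (ht : t ∈ Set.Icc 0 T) :
    energy (e t) ≤ Real.exp T * (energy (e 0) +
      T * (N * ((k + 1) * invMassBound k * β ^ 2))) := by
  have hh := meshSize_pos hx N
  refine le_exp_mul_of_deriv_le (by have := invMassBound_nonneg k; positivity) (energy_nonneg _)
    (fun t ht => hasDerivWithinAt_energy (he t ht)) (fun t ht => ?_) ht
  -- `d` is the velocity that the scheme prescribes at `e t`; it does no work on the energy, so only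
  -- `e' t - d` contributes.
  set d : DOF N k := (a • dgMatrix xa xb N k) *ᵥ e t with hd
  have hdM := (scheme_iff_dgMatrix hx a d (e t)).2 hd
  have hr : energy (e' t - d) ≤ N * ((k + 1) * invMassBound k * β ^ 2) := by
    refine energy_le fun j l => ?_
    have h1 := hres t ht j l
    have h2 : meshSize xa xb N • (massM k *ᵥ cellVec (e' t) j) - a • fluxOp (e t) j =
        meshSize xa xb N • (massM k *ᵥ cellVec (e' t - d) j) := by
      rw [← hdM j, ← smul_sub, ← mulVec_sub]; rfl
    rw [h2, Pi.smul_apply, smul_eq_mul, abs_mul, abs_of_pos hh] at h1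
    exact le_of_mul_le_mul_left h1 hh
  have hflux : ∑ j, cellVec (e t) j ⬝ᵥ massM k *ᵥ cellVec d j = 0 := by
    have h1 : meshSize xa xb N * ∑ j, cellVec (e t) j ⬝ᵥ massM k *ᵥ cellVec d j =
        a * ∑ j, cellVec (e t) j ⬝ᵥ fluxOp (e t) j := by
      rw [Finset.mul_sum, Finset.mul_sum]
      refine Finset.sum_congr rfl fun j _ => ?_
      rw [← smul_eq_mul, ← dotProduct_smul, hdM, dotProduct_smul, smul_eq_mul]
    rw [sum_dotProduct_fluxOp, mul_zero] at h1
    exact (mul_eq_zero.1 h1).resolve_left hh.ne'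
  have hsplit : ∑ j, cellVec (e t) j ⬝ᵥ massM k *ᵥ cellVec (e' t) j =
      ∑ j, cellVec (e t) j ⬝ᵥ massM k *ᵥ cellVec (e' t - d) j := by
    rw [← sub_zero (∑ j, cellVec (e t) j ⬝ᵥ massM k *ᵥ cellVec (e' t) j), ← hflux,
      ← Finset.sum_sub_distrib]
    refine Finset.sum_congr rfl fun j _ => ?_
    rw [← dotProduct_sub, ← mulVec_sub]; rfl
  rw [hsplit]
  linarith [two_mul_sum_massM_le (e t) (e' t - d)]

/-! ### Projection error and the semi-discrete estimate -/

lemma fluxOp_sub {N k : ℕ} [NeZero N] (v w : DOF N k) (j : Fin N) :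
    fluxOp (v - w) j = fluxOp v j - fluxOp w j := by
  have h : ∀ i, cellVec (v - w) i = cellVec v i - cellVec w i := fun _ => rfl
  simp only [fluxOp, h, mulVec_sub]; abel

lemma refPoly_single {k : ℕ} (l : Fin (k + 1)) (s : ℝ) :
    refPoly (Pi.single l 1) s = s ^ (l : ℕ) := by
  simp [refPoly, Pi.single_apply]

/-- The projection has the moments of `v`, so the entry is the cell mean of `w - v` against a
monomial bounded by `1`. -/
lemma abs_massM_mulVec_sub_projection_le {xa xb B : ℝ} (hx : xa < xb) {N k : ℕ} [NeZero N]
    {v : ℝ → ℝ} (hv : Continuous v) {w c : DOF N k} (hc : IsL2Projection xa xb v c)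
    (hB : ∀ j, ∀ x ∈ Set.Icc (leftEnd xa xb N j) (rightEnd xa xb N j),
      |v x - recon xa xb w j x| ≤ B) (j : Fin N) (l : Fin (k + 1)) :
    |(massM k *ᵥ cellVec (w - c) j) l| ≤ B := by
  have hh := meshSize_pos hx N
  have hlr := leftEnd_le_rightEnd hx j
  have h1 := IsL2Projection.dotProduct_massM hx hc j (Pi.single l 1)
  have h2 := integral_recon_mul hx w j (Pi.single l 1)
  have hcont : Continuous fun x =>
      refPoly (Pi.single l 1 : Fin (k + 1) → ℝ) (localCoord xa xb N j x) :=
    (continuous_refPoly _).comp (continuous_localCoord xa xb N j)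
  have hrec := continuous_recon xa xb w j
  have h3 : meshSize xa xb N * (massM k *ᵥ cellVec (w - c) j) l =
      ∫ x in (leftEnd xa xb N j)..(rightEnd xa xb N j), (recon xa xb w j x - v x) *
        refPoly (Pi.single l 1 : Fin (k + 1) → ℝ) (localCoord xa xb N j x) := by
    simp_rw [sub_mul]
    rw [intervalIntegral.integral_sub
      (Continuous.intervalIntegrable (by fun_prop) _ _)
      (Continuous.intervalIntegrable (by fun_prop) _ _), h2, ← h1, ← mul_sub, ← dotProduct_sub,
      ← mulVec_sub, single_one_dotProduct]
    rfl
  have h4 := intervalIntegral.norm_integral_le_of_norm_le_const (C := B)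
    (a := leftEnd xa xb N j) (b := rightEnd xa xb N j)
    (f := fun x => (recon xa xb w j x - v x) *
        refPoly (Pi.single l 1 : Fin (k + 1) → ℝ) (localCoord xa xb N j x)) (fun x hxj => by
      rw [Set.uIoc_of_le hlr] at hxj
      have hxj' := Set.Ioc_subset_Icc_self hxj
      rw [norm_mul, refPoly_single, norm_pow, Real.norm_eq_abs, Real.norm_eq_abs, abs_sub_comm]
      have h5 := hB j x hxj'
      calc _ ≤ B * 1 := mul_le_mul h5
            (pow_le_one₀ (abs_nonneg _) ((abs_localCoord_le hx hxj').trans (by norm_num)))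
            (by positivity) ((abs_nonneg _).trans h5)
        _ = B := mul_one B)
  rw [← h3, Real.norm_eq_abs, abs_mul, rightEnd_sub_leftEnd, abs_of_pos hh, mul_comm] at h4
  exact le_of_mul_le_mul_right h4 hh

/-- Split the error at `w` and use `(p + q)² ≤ 2 p² + 2 q²`. -/
lemma errL2_sq_le {xa xb B : ℝ} (hx : xa < xb) {N k : ℕ} [NeZero N] {v : ℝ → ℝ}
    (hv : Continuous v) {w c : DOF N k}
    (hB : ∀ j, ∀ x ∈ Set.Icc (leftEnd xa xb N j) (rightEnd xa xb N j),
      |v x - recon xa xb w j x| ≤ B) :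
    errL2 xa xb v c ^ 2 ≤
      2 * (xb - xa) * B ^ 2 + 2 * meshSize xa xb N * energy (w - c) := by
  have hh := meshSize_pos hx N
  have hcell : ∀ j : Fin N,
      ∫ x in (leftEnd xa xb N j)..(rightEnd xa xb N j), (v x - recon xa xb c j x) ^ 2 ≤
        2 * meshSize xa xb N * B ^ 2 + 2 * meshSize xa xb N *
          (cellVec (w - c) j ⬝ᵥ massM k *ᵥ cellVec (w - c) j) := by
    intro j
    have hc1 := continuous_recon xa xb c j
    have hc2 := continuous_recon xa xb (w - c) j
    have hsub : ∀ x, recon xa xb (w - c) j x = recon xa xb w j x - recon xa xb c j x := by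
      intro x
      simp only [recon, Pi.sub_apply, sub_mul, Finset.sum_sub_distrib]
    calc _ ≤ ∫ x in (leftEnd xa xb N j)..(rightEnd xa xb N j),
          (2 * B ^ 2 + 2 * (recon xa xb (w - c) j x * recon xa xb (w - c) j x)) := by
          refine intervalIntegral.integral_mono_on (leftEnd_le_rightEnd hx j)
            (((hv.sub hc1).pow 2).intervalIntegrable _ _)
            (Continuous.intervalIntegrable (by fun_prop) _ _) fun x hxj => ?_
          have h1 : (v x - recon xa xb w j x) ^ 2 ≤ B ^ 2 :=
            sq_le_sq' (abs_le.1 (hB j x hxj)).1 (abs_le.1 (hB j x hxj)).2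
          rw [hsub]
          nlinarith [sq_nonneg ((v x - recon xa xb w j x) -
            (recon xa xb w j x - recon xa xb c j x))]
      _ = _ := by
          rw [intervalIntegral.integral_add (Continuous.intervalIntegrable (by fun_prop) _ _)
            (Continuous.intervalIntegrable (by fun_prop) _ _), intervalIntegral.integral_const,
            intervalIntegral.integral_const_mul, rightEnd_sub_leftEnd, smul_eq_mul]
          have := integral_recon_mul hx (w - c) j (cellVec (w - c) j)
          simp_rw [← recon_eq] at this
          rw [this]; ring
  have hnn : 0 ≤ ∑ j : Fin N,
      ∫ x in (leftEnd xa xb N j)..(rightEnd xa xb N j), (v x - recon xa xb c j x) ^ 2 :=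
    Finset.sum_nonneg fun j _ => intervalIntegral.integral_nonneg (leftEnd_le_rightEnd hx j)
      fun _ _ => sq_nonneg _
  rw [errL2, Real.sq_sqrt hnn]
  refine (Finset.sum_le_sum fun j _ => hcell j).trans (le_of_eq ?_)
  rw [Finset.sum_add_distrib, Finset.sum_const, Finset.card_univ,
    Fintype.card_fin, nsmul_eq_mul, energy, ← meshSize_mul xa xb N]
  congr 1
  · ring
  · rw [Finset.mul_sum]

lemma IsSemiDiscreteDG.derivWithin_eq {a xa xb T : ℝ} (hx : xa < xb) {N k : ℕ} [NeZero N]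
    {u₀ : ℝ → ℝ} {c : ℝ → DOF N k} (hc : IsSemiDiscreteDG a xa xb T u₀ c) {t : ℝ}
    (ht : t ∈ Set.Icc 0 T) :
    derivWithin c (Set.Icc 0 T) t = (a • dgMatrix xa xb N k) *ᵥ c t :=
  (scheme_iff_dgMatrix hx a _ _).1 fun j => (scheme_iff hx a _ _ j).1 (hc.scheme t ht j)

/-- The error estimate of the semi-discrete scheme, for the exact solution `u₀ (x - a t)`. -/
lemma IsSemiDiscreteDG.errL2_sq_le {a xa xb T K : ℝ} (hx : xa < xb) {N k : ℕ}
    [NeZero N] {u₀ : ℝ → ℝ} (hu₀ : ContDiff ℝ (k + 1 : ℕ) u₀)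
    (hper : Function.Periodic u₀ (xb - xa)) (hK : ∀ x, |iteratedDeriv (k + 1) u₀ x| ≤ K)
    {c : ℝ → DOF N k} (hc : IsSemiDiscreteDG a xa xb T u₀ c) {t : ℝ} (ht : t ∈ Set.Icc 0 T) :
    errL2 xa xb (fun x => u₀ (x - a * t)) (c t) ^ 2 ≤
      (2 * (xb - xa) * (K * (xb - xa)) ^ 2 + 2 * (xb - xa) * (Real.exp T * ((k + 1) *
        invMassBound k * (K * (xb - xa)) ^ 2 + T * ((k + 1) * invMassBound k *
          (3 * |a| * K) ^ 2)))) * (meshSize xa xb N ^ k) ^ 2 := by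
  have hh := meshSize_pos hx N
  have hK0 : 0 ≤ K := (abs_nonneg _).trans (hK 0)
  set h := meshSize xa xb N with hh_def
  set w := taylorDOF a xa xb N k u₀ with hw
  set w' := taylorDOFDeriv a xa xb N k u₀ with hw'
  -- One power of `h` is traded for `xb - xa`, because the stability term is only of order `h ^ k`.
  have hB : K * h ^ (k + 1) ≤ K * (xb - xa) * h ^ k := by
    rw [pow_succ', mul_assoc]
    exact mul_le_mul_of_nonneg_left (mul_le_mul_of_nonneg_right (meshSize_le hx N)
      (by positivity)) hK0
  have happrox : ∀ s, ∀ j, ∀ x ∈ Set.Icc (leftEnd xa xb N j) (rightEnd xa xb N j),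
      |u₀ (x - a * s) - recon xa xb (w s) j x| ≤ K * (xb - xa) * h ^ k := fun s j x hxj =>
    (abs_sub_recon_taylorDOF_le hx hu₀ hK s hxj).trans hB
  have hstab : energy (w t - c t) ≤ Real.exp T * (energy (w 0 - c 0) +
      T * (N * ((k + 1) * invMassBound k * (3 * |a| * K * h ^ k) ^ 2))) := by
    refine energy_le_of_residual_le (a := a) (e := fun t => w t - c t)
      (e' := fun t => w' t - derivWithin c (Set.Icc 0 T) t) hx (fun s hs => ?_)
      (fun s hs j l => ?_) ht
    · exact (hasDerivAt_taylorDOF a xa xb N k hu₀ s).hasDerivWithinAt.sub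
        (hc.differentiable s hs).hasDerivWithinAt
    · have h1 := (scheme_iff hx a _ _ j).1 (hc.scheme s hs j)
      have h2 : h • (massM k *ᵥ cellVec (w' s - derivWithin c (Set.Icc 0 T) s) j) -
          a • fluxOp (w s - c s) j =
          h • (massM k *ᵥ cellVec (w' s) j) - a • fluxOp (w s) j := by
        have h3 : cellVec (w' s - derivWithin c (Set.Icc 0 T) s) j =
          cellVec (w' s) j - cellVec (derivWithin c (Set.Icc 0 T) s) j := rfl
        rw [h3, mulVec_sub, smul_sub, h1, fluxOp_sub, smul_sub, sub_sub_sub_cancel_right]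
      rw [h2]
      refine (abs_residual_le hx hu₀ hper hK s j l).trans (le_of_eq ?_)
      rw [pow_succ]; ring
  have hinit : energy (w 0 - c 0) ≤
      N * ((k + 1) * invMassBound k * (K * (xb - xa) * h ^ k) ^ 2) := by
    refine energy_le (abs_massM_mulVec_sub_projection_le hx hu₀.continuous hc.initial ?_)
    intro j x hxj
    simpa using happrox 0 j x hxj
  have hfin := ExpDG.errL2_sq_le hx (v := fun x => u₀ (x - a * t)) (c := c t)
    (hu₀.continuous.comp (by fun_prop)) (happrox t)
  refine hfin.trans ?_
  have hE : energy (w t - c t) ≤ Real.exp T * (N * ((k + 1) * invMassBound k *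
      (K * (xb - xa) * h ^ k) ^ 2) + T * (N * ((k + 1) * invMassBound k *
        (3 * |a| * K * h ^ k) ^ 2))) :=
    hstab.trans (mul_le_mul_of_nonneg_left (by linarith) (Real.exp_pos _).le)
  have := mul_le_mul_of_nonneg_left hE (show 0 ≤ 2 * h by positivity)
  rw [← hh_def]
  refine (add_le_add_right this _).trans (le_of_eq ?_)
  -- The number of cells in the energy bounds is absorbed by the factor `h` of the `L²` norm.
  have hN : N * h = xb - xa := meshSize_mul xa xb N
  linear_combination (2 * (Real.exp T * ((k + 1) * invMassBound k * (K * (xb - xa)) ^ 2 +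
    T * ((k + 1) * invMassBound k * (3 * |a| * K) ^ 2))) * (h ^ k) ^ 2) * hN

/-! ### The matrix exponential flow -/

section

-- An auxiliary submultiplicative norm, used only to differentiate the exponential.
attribute [local instance] Matrix.linftyOpNormedRing Matrix.linftyOpNormedAlgebra

lemma hasDerivAt_exp_smul_mulVec {ι : Type*} [Fintype ι] [DecidableEq ι] (A : Matrix ι ι ℝ)
    (v : ι → ℝ) (t : ℝ) :
    HasDerivAt (fun s : ℝ => NormedSpace.exp (s • A) *ᵥ v)
      (A *ᵥ (NormedSpace.exp (t • A) *ᵥ v)) t := by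
  have h := hasDerivAt_exp_smul_const' (𝕂 := ℝ) A t
  set Φ : Matrix ι ι ℝ →L[ℝ] (ι → ℝ) :=
    LinearMap.toContinuousLinearMap ((mulVecBilin ℝ ℝ).flip v) with hΦ
  have h2 := (Φ.hasFDerivAt (x := NormedSpace.exp (t • A))).comp_hasDerivAt t h
  rw [mulVec_mulVec]
  exact h2

end

/-- The exponential flow solves the semi-discrete scheme. -/
lemma isSemiDiscreteDG_exp {a xa xb T : ℝ} (hx : xa < xb) (hT : 0 < T) {N k : ℕ} [NeZero N]
    {u₀ : ℝ → ℝ} {c₀ : DOF N k} (h₀ : IsL2Projection xa xb u₀ c₀) :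
    IsSemiDiscreteDG a xa xb T u₀
      (fun t => NormedSpace.exp (t • a • dgMatrix xa xb N k) *ᵥ c₀) where
  differentiable t _ :=
    (hasDerivAt_exp_smul_mulVec _ c₀ t).differentiableAt.differentiableWithinAt
  initial := by simpa using h₀
  scheme t ht j := by
    refine (scheme_iff hx a _ _ j).2 ((scheme_iff_dgMatrix hx a _ _).2 ?_ j)
    exact (hasDerivAt_exp_smul_mulVec _ c₀ t).hasDerivWithinAt.derivWithin
      (uniqueDiffOn_Icc hT t ht)

/-- Every solution of the semi-discrete scheme is the exponential flow. -/
lemma IsSemiDiscreteDG.eq_exp {a xa xb T : ℝ} (hx : xa < xb) {N k : ℕ}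
    [NeZero N] {u₀ : ℝ → ℝ} {c : ℝ → DOF N k} (hc : IsSemiDiscreteDG a xa xb T u₀ c) {t : ℝ}
    (ht : t ∈ Set.Icc 0 T) :
    c t = NormedSpace.exp (t • a • dgMatrix xa xb N k) *ᵥ c 0 := by
  set A := a • dgMatrix xa xb N k with hA
  have hexp := hasDerivAt_exp_smul_mulVec A (c 0)
  set Φ : DOF N k →L[ℝ] DOF N k := LinearMap.toContinuousLinearMap A.mulVecLin with hΦ
  refine ODE_solution_unique (v := fun _ => Φ) (fun _ => Φ.lipschitz)
    hc.differentiable.continuousOn (fun s hs => ?_)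
    (g := fun t => NormedSpace.exp (t • A) *ᵥ c 0)
    (fun s _ => (hexp s).continuousAt.continuousWithinAt)
    (fun s _ => (hexp s).hasDerivWithinAt) (by simp) ht
  have hs' := Set.Ico_subset_Icc_self hs
  have h1 := (hc.differentiable s hs').hasDerivWithinAt
  rw [hc.derivWithin_eq hx hs'] at h1
  -- Uniqueness asks only for right derivatives on `[0, T)`, which the derivative within `[0, T]`
  -- supplies.
  exact (h1.mono (Set.Icc_subset_Icc_left hs.1)).mono_of_mem_nhdsWithin
    (Icc_mem_nhdsGE hs.2)

lemma IsExpDG.eq_exp {a xa xb Δt : ℝ} {N k : ℕ} [NeZero N] {u₀ : ℝ → ℝ} {U : ℕ → DOF N k}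
    (hU : IsExpDG a xa xb Δt u₀ U) (n : ℕ) :
    U n = NormedSpace.exp ((n * Δt : ℝ) • a • dgMatrix xa xb N k) *ᵥ U 0 := by
  have h : ∀ n : ℕ, U n = (NormedSpace.exp ((a * Δt) • dgMatrix xa xb N k)) ^ n *ᵥ U 0 := by
    intro n
    induction n with
    | zero => simp
    | succ n ih => rw [hU.step, ih, mulVec_mulVec, ← pow_succ']
  rw [h, ← Matrix.exp_nsmul, ← Nat.cast_smul_eq_nsmul ℝ, smul_smul, smul_smul]
  congr 3; ring

end ExpDG

end

theorem mainTheorem4 (a xa xb T : ℝ) (hx : xa < xb) (hT : 0 < T) (k : ℕ)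
    (u₀ : ℝ → ℝ) (hu₀ : ContDiff ℝ ((k + 1 : ℕ) : WithTop ℕ∞) u₀)
    (hper : Function.Periodic u₀ (xb - xa))
    (u : ℝ → ℝ → ℝ) (hu : ExpDG.IsTransportSolution a xa xb T u₀ u) :
    ∃ C : ℝ, 0 < C ∧ ∀ (N : ℕ) [NeZero N],
      -- the semi-discrete scheme
      (∀ c : ℝ → ExpDG.DOF N k, ExpDG.IsSemiDiscreteDG a xa xb T u₀ c →
        ∀ t ∈ Set.Icc 0 T, ExpDG.errL2 xa xb (u t) (c t) ≤ C * ExpDG.meshSize xa xb N ^ k) ∧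
      -- the exponential scheme, and its exactness in time
      (∀ (Δt : ℝ), 0 < Δt → ∀ U : ℕ → ExpDG.DOF N k, ExpDG.IsExpDG a xa xb Δt u₀ U →
        ∀ n : ℕ, n * Δt ≤ T →
          ExpDG.errL2 xa xb (u (n * Δt)) (U n) ≤ C * ExpDG.meshSize xa xb N ^ k ∧
          ∀ c : ℝ → ExpDG.DOF N k, ExpDG.IsSemiDiscreteDG a xa xb T u₀ c →
            c (n * Δt) = U n) := by
  obtain ⟨K, hK⟩ := ExpDG.exists_abs_iteratedDeriv_le (sub_pos.2 hx).ne' hper hu₀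
  -- `G` is chosen before `N`: the explicit bound involves the mesh only through `h ^ k`.
  obtain ⟨G, hG⟩ : ∃ G : ℝ, ∀ (N : ℕ) [NeZero N] (c : ℝ → ExpDG.DOF N k),
      ExpDG.IsSemiDiscreteDG a xa xb T u₀ c → ∀ t ∈ Set.Icc 0 T,
      ExpDG.errL2 xa xb (fun x => u₀ (x - a * t)) (c t) ^ 2 ≤
        G * (ExpDG.meshSize xa xb N ^ k) ^ 2 :=
    ⟨_, fun N _ c hc t ht => hc.errL2_sq_le hx hu₀ hper hK ht⟩
  have hmain : ∀ (N : ℕ) [NeZero N] (c : ℝ → ExpDG.DOF N k),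
      ExpDG.IsSemiDiscreteDG a xa xb T u₀ c → ∀ t ∈ Set.Icc 0 T,
      ExpDG.errL2 xa xb (u t) (c t) ≤ (Real.sqrt G + 1) * ExpDG.meshSize xa xb N ^ k := by
    intro N _ c hc t ht
    have hp : 0 < ExpDG.meshSize xa xb N ^ k := pow_pos (ExpDG.meshSize_pos hx N) k
    rw [funext fun x => hu.eq_initial hT ht x]
    refine (Real.le_sqrt_of_sq_le (hG N c hc t ht)).trans ?_
    rw [Real.sqrt_mul' _ (sq_nonneg _), Real.sqrt_sq hp.le]
    exact mul_le_mul_of_nonneg_right (by linarith) hp.le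
  -- The added `1` makes the constant positive even when `Real.sqrt G = 0`.
  refine ⟨Real.sqrt G + 1, by positivity, fun N _ => ⟨hmain N, fun Δt hΔ U hU n hn => ?_⟩⟩
  have ht : (n * Δt : ℝ) ∈ Set.Icc 0 T := ⟨by positivity, hn⟩
  constructor
  · rw [hU.eq_exp n]
    -- The exponential flow from `U 0` is itself a semi-discrete solution.
    exact hmain N _ (ExpDG.isSemiDiscreteDG_exp hx hT hU.initial) _ ht
  · intro c hc
    rw [hc.eq_exp hx ht, hU.eq_exp n, hc.initial.unique hx hU.initial]
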